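/- Let $d\ge 3$ and $1\le p<\frac{2d}{d+2}$, and let $p'$ be the exponent conjugate to $p$, i.e. $\frac1p+\frac1{p'}=1$ (so $p'=\infty$ if $p=1$). There is a constant $C<\infty$, depending only on $d$ and $p$, with the following property. Let $f\in L^1(\mathbb R^d)\cap L^p(\mathbb R^d)$ be a complex-valued function whose periodizations $$g_\rho(x)=\sum_{\nu\in\mathbb Z^d} f(\rho(x-\nu))$$ vanish identically (that is, $g_\rho(x)=0$ for almost every $x$) for almost every rotation $\rho\in SO(d)$ with respect to Haar measure. Then for every $r$ with $p\le r\le p'$ one has $f\in L^r(\mathbb R^d)$ and $$\|f\|_r\le C\,\|f\|_p .$$ -/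

import Mathlib

open MeasureTheory
open scoped ENNReal NNReal Matrix

noncomputable section

namespace VanishingPeriodizations

/-- `d`-dimensional Euclidean space. -/
abbrev E (d : ℕ) : Type := EuclideanSpace ℝ (Fin d)

/-- The group `SO(d)` of rotations, with the topology induced from matrices. -/
abbrev SO (d : ℕ) : Type := Matrix.specialOrthogonalGroup (Fin d) ℝ

instance instIsTopologicalGroupSO (d : ℕ) : IsTopologicalGroup (SO d) where
  continuous_mul :=
    ((continuous_subtype_val.comp continuous_fst).matrix_mul
      (continuous_subtype_val.comp continuous_snd)).subtype_mk _
  continuous_inv := (continuous_subtype_val.matrix_conjTranspose).subtype_mk _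

theorem isCompact_SO (d : ℕ) :
    IsCompact ((Matrix.specialOrthogonalGroup (Fin d) ℝ : Submonoid _) :
      Set (Matrix (Fin d) (Fin d) ℝ)) := by
  have hK : IsCompact (Set.univ.pi fun _ : Fin d => Set.univ.pi fun _ : Fin d =>
      Set.Icc (-1 : ℝ) 1) :=
    isCompact_univ_pi fun _ => isCompact_univ_pi fun _ => isCompact_Icc
  have hcl : IsClosed {A : Matrix (Fin d) (Fin d) ℝ | A * Aᵀ = 1 ∧ A.det = 1} := by
    have h1 : Continuous fun A : Matrix (Fin d) (Fin d) ℝ => A * Aᵀ :=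
      continuous_id.matrix_mul continuous_id.matrix_transpose
    have h2 : Continuous fun A : Matrix (Fin d) (Fin d) ℝ => A.det :=
      continuous_id.matrix_det
    exact (isClosed_eq h1 continuous_const).inter (isClosed_eq h2 continuous_const)
  have heq : ((Matrix.specialOrthogonalGroup (Fin d) ℝ : Submonoid _) :
      Set (Matrix (Fin d) (Fin d) ℝ)) = {A | A * Aᵀ = 1 ∧ A.det = 1} := by
    ext A
    simp only [SetLike.mem_coe, Matrix.mem_specialOrthogonalGroup_iff,
      Matrix.mem_orthogonalGroup_iff, Set.mem_ofPred_eq]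
  refine hK.of_isClosed_subset (heq ▸ hcl) ?_
  intro A hA
  have hU : A ∈ Matrix.unitaryGroup (Fin d) ℝ :=
    (Matrix.mem_specialOrthogonalGroup_iff.1 hA).1
  intro i _ j _
  exact abs_le.1 (by simpa using entry_norm_bound_of_unitary hU i j)

instance instCompactSpaceSO (d : ℕ) : CompactSpace (SO d) :=
  isCompact_iff_compactSpace.1 (isCompact_SO d)

instance instMeasurableSpaceSO (d : ℕ) : MeasurableSpace (SO d) := borel (SO d)

instance instBorelSpaceSO (d : ℕ) : BorelSpace (SO d) := ⟨rfl⟩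

/-- The rotation `ρ` applied to the vector `x`. -/
def rot {d : ℕ} (ρ : SO d) (x : E d) : E d := WithLp.toLp 2 (ρ.1 *ᵥ x.ofLp)

/-- The point of `ℝ^d` with integer coordinates `ν`. -/
def latticePt {d : ℕ} (ν : Fin d → ℤ) : E d := WithLp.toLp 2 fun i => (ν i : ℝ)

/-- The periodization `g_ρ(x) = ∑_{ν ∈ ℤ^d} f(ρ(x - ν))`. For integrable `f` the series
converges absolutely for almost every `x`. -/
def periodization {d : ℕ} (f : E d → ℂ) (ρ : SO d) (x : E d) : ℂ :=
  ∑' ν : Fin d → ℤ, f (rot ρ (x - latticePt ν))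

/-- For almost every rotation `ρ` (with respect to Haar measure on `SO(d)`) the periodization
`g_ρ` vanishes identically (as a locally integrable function, i.e. almost everywhere). -/
def HasVanishingPeriodizations {d : ℕ} (f : E d → ℂ) : Prop :=
  ∀ᵐ ρ ∂(Measure.haar : Measure (SO d)), ∀ᵐ x ∂(volume : Measure (E d)),
    periodization f ρ x = 0

end VanishingPeriodizations

end

namespace VanishingPeriodizations

open scoped FourierTransform RealInnerProductSpace

/-! If the `ℤ^d`-periodization of `f ∘ ρ` vanishes, so does the Fourier transform of `f` at `ρ m`
for every lattice point `m`. Letting `ρ` vary, `𝓕 f` vanishes on every origin-centred sphere through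
a lattice point. Since `d ≥ 3`, and integers congruent to 3 modulo 8 are sums of three squares
(`exists_sum_three_sq`), this covers all spheres `‖ξ‖² = 8k + 3`, an arithmetic progression in the
squared radius.

Poisson summation over this progression, applied to the density in `s = ‖ξ‖²` of `exp(-ε‖ξ‖² +
2πi⟪x, ξ⟫) 𝓕 f(ξ)`, gives `∑ₙ e^{2πi·3n/8} T_{ε + πin/4} f(x) = 0` (`hasSum_gaussOp`), where `T_z`
is the multiplier with symbol `exp(-z‖ξ‖²)`. So the regularization `T_ε f` is minus the sum of the
terms with `n ≠ 0`. These are Schrödinger-type evolutions and disperse: `T_z` maps `L¹` to `L^∞`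
with norm at most `(π/|z|)^{d/2}`, because its kernel is an explicit Gaussian, and contracts `L²`.
By interpolation (`eLpNorm_gaussOp_le`) it maps `L^p` to `L^{p'}` with norm at most a constant times
`|z|^{-γ}`, `γ = (d/2)(2/p - 1)`. The sum over `n ≠ 0` is at most a constant times `∑ |n|^{-γ}`, and
`γ > 1` is exactly `p < 2d/(d+2)`.

The bound on `T_ε f` is uniform in `ε`, so Fatou's lemma along a sequence `ε → 0` bounds `‖f‖_{p'}`
by `‖f‖_p`; intermediate exponents follow by comparing powers pointwise. -/

/-! ### Arithmetic: sums of three squares in the class 3 modulo 8, by Minkowski's theorem. -/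

theorem even_padicValNat_of_eq_sq_add_mul_sq {p : ℕ} [Fact p.Prime] {m : ℤ}
    (hm : ¬ IsSquare (-(m : ZMod p))) :
    ∀ n : ℕ, n ≠ 0 → ∀ a y : ℤ, (n : ℤ) = a ^ 2 + m * y ^ 2 → Even (padicValNat p n) := by
  intro n
  induction n using Nat.strong_induction_on with
  | _ n ih =>
    intro hn a y h
    by_cases hpn : p ∣ n
    · have h0 : ((a : ZMod p)) ^ 2 + m * (y : ZMod p) ^ 2 = 0 := by
        have : ((n : ℤ) : ZMod p) = ((a ^ 2 + m * y ^ 2 : ℤ) : ZMod p) := by rw [h]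
        push_cast at this
        rw [← this]
        exact (ZMod.natCast_eq_zero_iff n p).2 hpn
      -- As `-m` is not a square modulo `p`, the form is anisotropic there. So `p` divides both `a`
      -- and `y`, a factor `p ^ 2` splits off, and descent applies.
      have hy : (y : ZMod p) = 0 := by
        by_contra hy
        refine hm ⟨a / y, ?_⟩
        field_simp
        linear_combination -h0
      have ha : (a : ZMod p) = 0 := by
        rw [hy] at h0
        simpa using h0
      obtain ⟨a', rfl⟩ := (ZMod.intCast_zmod_eq_zero_iff_dvd a p).1 ha
      obtain ⟨y', rfl⟩ := (ZMod.intCast_zmod_eq_zero_iff_dvd y p).1 hy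
      have hdvd : ((p ^ 2 : ℕ) : ℤ) ∣ (n : ℤ) := ⟨a' ^ 2 + m * y' ^ 2, by rw [h]; push_cast; ring⟩
      obtain ⟨n', rfl⟩ := Int.natCast_dvd_natCast.1 hdvd
      have hp := (Fact.out : p.Prime)
      have hn' : n' ≠ 0 := by rintro rfl; simp at hn
      have hlt : n' < p ^ 2 * n' := by
        have : 1 < p ^ 2 := Nat.one_lt_pow two_ne_zero hp.one_lt
        nlinarith [Nat.pos_of_ne_zero hn']
      have key : (n' : ℤ) = a' ^ 2 + m * y' ^ 2 := by
        have hp0 : ((p : ℤ) ^ 2) ≠ 0 := pow_ne_zero 2 (by exact_mod_cast hp.ne_zero)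
        apply mul_left_cancel₀ hp0
        push_cast at h
        linear_combination h
      have hev := ih n' hlt hn' a' y' key
      rw [padicValNat.mul (pow_ne_zero 2 hp.ne_zero) hn', padicValNat.prime_pow]
      exact even_two.add hev
    · rw [padicValNat.eq_zero_of_not_dvd hpn]
      exact Even.zero

/-- Minkowski's theorem for the ellipsoid `M⁻¹(ball)`, whose volume is `(4π/3) r³ / |det M|`; it
must exceed `2³` times the covolume 1 of `ℤ³`. -/
theorem exists_int_vec_sum_sq_lt (M : Matrix (Fin 3) (Fin 3) ℝ) (hM : M.det ≠ 0) {r : ℝ}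
    (hr : 0 < r) (h : 8 * |M.det| < r ^ 3 * (Real.pi * 4 / 3)) :
    ∃ v : Fin 3 → ℤ, v ≠ 0 ∧ ∑ i, (M *ᵥ fun j => (v j : ℝ)) i ^ 2 < r ^ 2 := by
  set S : Set (Fin 3 → ℝ) := WithLp.toLp 2 ⁻¹' Metric.ball (0 : EuclideanSpace ℝ (Fin 3)) r with hS
  have hSv : volume S = ENNReal.ofReal (r ^ 3 * (Real.pi * 4 / 3)) := by
    rw [hS, (PiLp.volume_preserving_toLp (Fin 3)).measure_preimage
      measurableSet_ball.nullMeasurableSet, EuclideanSpace.volume_ball_fin_three,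
      ENNReal.ofReal_mul (by positivity), ENNReal.ofReal_pow hr.le]
  have hS' : ∀ x, x ∈ S ↔ ∑ i, x i ^ 2 < r ^ 2 := by
    intro x
    simp only [hS, Set.mem_preimage, mem_ball_zero_iff, EuclideanSpace.norm_eq, Real.norm_eq_abs,
      sq_abs]
    rw [Real.sqrt_lt' hr]
  have hSc : Convex ℝ S :=
    (convex_ball (0 : EuclideanSpace ℝ (Fin 3)) r).is_linear_preimage
      (WithLp.linearEquiv 2 ℝ (Fin 3 → ℝ)).symm.toLinearMap.isLinear
  have hdet : LinearMap.det (Matrix.toLin' M) ≠ 0 := by rwa [LinearMap.det_toLin']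
  let b := Pi.basisFun ℝ (Fin 3)
  have hfd := ZSpan.isAddFundamentalDomain b (volume : Measure (Fin 3 → ℝ))
  have : Countable (Submodule.span ℤ (Set.range b)).toAddSubgroup :=
    inferInstanceAs (Countable (Submodule.span ℤ (Set.range b)))
  obtain ⟨x, hx0, hx⟩ := exists_ne_zero_mem_lattice_of_measure_mul_two_pow_lt_measure
    (L := (Submodule.span ℤ (Set.range b)).toAddSubgroup) (s := Matrix.toLin' M ⁻¹' S) hfd
    (by
      intro x hx
      rw [Set.mem_preimage, hS'] at hx ⊢
      simpa [Matrix.mulVec_neg] using hx)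
    (hSc.is_linear_preimage (Matrix.toLin' M).isLinear)
    (by
      rw [Measure.addHaar_preimage_linearMap _ hdet, hSv, ZSpan.fundamentalDomain_pi_basisFun,
        LinearMap.det_toLin', ← ENNReal.ofReal_mul (abs_nonneg _), Real.volume_pi_Ico]
      simp only [sub_zero, ENNReal.ofReal_one, Finset.prod_const_one, one_mul,
        Module.finrank_fintype_fun_eq_card, Fintype.card_fin]
      have e : (2 : ℝ≥0∞) ^ 3 = ENNReal.ofReal 8 := by
        rw [ENNReal.ofReal_ofNat]; norm_num
      rw [e]
      have hpos := abs_pos.2 hM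
      apply (ENNReal.ofReal_lt_ofReal_iff (by positivity)).2
      rw [abs_inv, inv_mul_eq_div, lt_div_iff₀ hpos]
      exact h)
  have hmem := (b.mem_span_iff_repr_mem ℤ (x : Fin 3 → ℝ)).1 x.2
  choose v hv using hmem
  have hv' : (fun j => (v j : ℝ)) = (x : Fin 3 → ℝ) := by
    ext j
    simpa [b] using hv j
  refine ⟨v, ?_, ?_⟩
  · rintro rfl
    apply hx0
    apply Subtype.ext
    rw [← hv']
    ext j; simp
  · rw [hv']
    rw [Set.mem_preimage, hS'] at hx
    simpa using hx

/-- Dirichlet's theorem: for `m = 8k + 3` the class `4k + 1` modulo `4m` is a unit, is 1 modulo 4,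
and is a solution of `2q ≡ -1` modulo `m`. Taking `q > m` excludes `q ∣ m`. -/
theorem exists_auxiliary_prime {m : ℕ} (hm : m % 8 = 3) :
    ∃ q : ℕ, q.Prime ∧ q % 4 = 1 ∧ ((2 * q + 1 : ℕ) : ZMod m) = 0 ∧ ¬ q ∣ m := by
  obtain ⟨k, rfl⟩ : ∃ k, m = 8 * k + 3 := ⟨m / 8, by omega⟩
  have : NeZero (4 * (8 * k + 3)) := ⟨by omega⟩
  have hcop : Nat.Coprime (4 * k + 1) (4 * (8 * k + 3)) := by
    apply Nat.Coprime.mul_right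
    · simp [Nat.Coprime]
    · have : 8 * k + 3 = 1 + 2 * (4 * k + 1) := by ring
      rw [this]
      simp
  obtain ⟨q, hq1, hq, hqa⟩ := Nat.forall_exists_prime_gt_and_eq_mod
    ((ZMod.isUnit_iff_coprime _ _).2 hcop) (8 * k + 3)
  rw [ZMod.natCast_eq_natCast_iff] at hqa
  refine ⟨q, hq, ?_, ?_, ?_⟩
  · have := hqa.of_mul_right (8 * k + 3)
    unfold Nat.ModEq at this
    omega
  · have h2 : q ≡ 4 * k + 1 [MOD 8 * k + 3] := hqa.of_mul_left 4
    have h3 := (ZMod.natCast_eq_natCast_iff _ _ _).2 h2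
    have h4 : ((8 * k + 3 : ℕ) : ZMod (8 * k + 3)) = 0 := ZMod.natCast_self _
    push_cast at h3 h4 ⊢
    linear_combination 2 * h3 + h4
  · intro h
    exact absurd (Nat.le_of_dvd (by omega) h) (by omega)

/-- By reciprocity `(-m/q) = (q/m)`. This is 1 because `(-2/m) = 1` for `m ≡ 3` modulo 8 and `-2q ≡
1` modulo `m`. -/
theorem isSquare_neg_mod_auxiliary_prime {m q : ℕ} (hm : m % 8 = 3) (hq : q.Prime)
    (hq4 : q % 4 = 1) (hqm : ((2 * q + 1 : ℕ) : ZMod m) = 0) (hnd : ¬ q ∣ m) :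
    IsSquare (-(m : ZMod q)) := by
  have := Fact.mk hq
  have hmodd : Odd m := Nat.odd_iff.2 (by omega)
  have h0 : ((-(m : ℤ) : ℤ) : ZMod q) ≠ 0 := by
    push_cast
    rw [neg_ne_zero, Ne, ZMod.natCast_eq_zero_iff]
    exact hnd
  have hq' : Odd q := Nat.odd_iff.2 (by omega)
  have h1 : jacobiSym (-2) m = 1 := by
    rw [jacobiSym.at_neg_two hmodd, ZMod.χ₈'_nat_eq_if_mod_eight]
    simp [hm, show ¬ m % 2 = 0 by omega]
  have h2 : jacobiSym (-2 * q) m = 1 := by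
    have : (-2 * q : ℤ) ≡ 1 [ZMOD m] := by
      rw [← ZMod.intCast_eq_intCast_iff]
      push_cast at hqm ⊢
      linear_combination -hqm
    rw [jacobiSym.mod_left' this, jacobiSym.one_left]
  rw [jacobiSym.mul_left, h1, one_mul] at h2
  have h3 : jacobiSym (-(m : ℤ)) q = 1 := by
    rw [jacobiSym.neg _ hq', ZMod.χ₄_nat_one_mod_four hq4, one_mul,
      ← jacobiSym.quadratic_reciprocity_one_mod_four hq4 hmodd, h2]
  rw [← jacobiSym.legendreSym.to_jacobiSym, legendreSym.eq_one_iff q h0] at h3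
  simpa using h3

theorem exists_odd_sq_add_eq {m q : ℕ} (hm : m % 8 = 3) (hq4 : q % 4 = 1)
    (hs : IsSquare (-(m : ZMod q))) : ∃ b h : ℤ, b ^ 2 + m = 4 * q * h := by
  have : NeZero q := ⟨by omega⟩
  obtain ⟨c, hc⟩ := hs
  obtain ⟨b0, rfl⟩ := ZMod.intCast_surjective c
  -- The root is made odd by adding `q` if necessary, so that 4 also divides `b ^ 2 + m`.
  obtain ⟨b, hbo, hb⟩ : ∃ b : ℤ, b % 2 = 1 ∧ (b : ZMod q) = b0 := by
    rcases Int.emod_two_eq_zero_or_one b0 with h | h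
    · exact ⟨b0 + q, by omega, by simp⟩
    · exact ⟨b0, h, rfl⟩
  have h1 : (q : ℤ) ∣ b ^ 2 + m := by
    rw [← ZMod.intCast_zmod_eq_zero_iff_dvd]
    push_cast
    rw [hb]
    linear_combination -hc
  have h2 : (4 : ℤ) ∣ b ^ 2 + m := by
    obtain ⟨k, rfl⟩ : ∃ k, b = 2 * k + 1 := ⟨b / 2, by omega⟩
    obtain ⟨j, rfl⟩ : ∃ j, m = 8 * j + 3 := ⟨m / 8, by omega⟩
    exact ⟨k ^ 2 + k + 2 * j + 1, by push_cast; ring⟩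
  have hcop : IsCoprime (4 : ℤ) (q : ℤ) := by
    have : Nat.Coprime 4 q := by
      have h2 : Nat.Coprime 2 q := (Nat.coprime_two_left).2 (Nat.odd_iff.2 (by omega))
      exact Nat.Coprime.pow_left 2 h2
    exact_mod_cast Nat.isCoprime_iff_coprime.2 this
  obtain ⟨h, hh⟩ := hcop.mul_dvd h2 h1
  exact ⟨b, h, hh⟩

/-- Completing the square, `2(qx² + bxy + hy²) = (√(2q) x + b y/√(2q))² + (m/2q) y²`. The ternary
form is therefore a sum of squares of linear forms with determinant `m^{3/2}`. -/
theorem exists_small_ternary_value {m q : ℕ} (hm : 0 < m) (hq : 0 < q) {b h : ℤ}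
    (hb : b ^ 2 + m = 4 * q * h) :
    ∃ x y z : ℤ, 0 < (2 * q * x + b * y + m * z) ^ 2 + 2 * (q * x ^ 2 + b * x * y + h * y ^ 2) ∧
      (2 * q * x + b * y + m * z) ^ 2 + 2 * (q * x ^ 2 + b * x * y + h * y ^ 2) < 2 * m := by
  have hmR : (0 : ℝ) < m := by exact_mod_cast hm
  have hqR : (0 : ℝ) < 2 * q := by exact_mod_cast (by omega : 0 < 2 * q)
  set s := √(2 * q : ℝ) with hs
  have hs0 : 0 < s := Real.sqrt_pos.2 hqR
  have hs2 : s ^ 2 = 2 * q := Real.sq_sqrt hqR.le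
  set t := √(m : ℝ) with ht
  have ht0 : 0 < t := Real.sqrt_pos.2 hmR
  have ht2 : t ^ 2 = m := Real.sq_sqrt hmR.le
  have hbR : (b : ℝ) ^ 2 + m = 4 * q * h := by exact_mod_cast hb
  let M : Matrix (Fin 3) (Fin 3) ℝ := !![2 * q, b, m; s, b / s, 0; 0, t / s, 0]
  have hdet : M.det = m * t := by
    simp only [M, Matrix.det_fin_three, Matrix.of_apply, Matrix.cons_val]
    field_simp
    ring
  have hsum : ∀ x y z : ℝ, ∑ i, (M *ᵥ ![x, y, z]) i ^ 2 =
      (2 * q * x + b * y + m * z) ^ 2 + 2 * (q * x ^ 2 + b * x * y + h * y ^ 2) := by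
    intro x y z
    simp only [M, Matrix.mulVec, dotProduct, Fin.sum_univ_three, Matrix.of_apply, Matrix.cons_val]
    have e : (s * x + b / s * y + 0 * z) ^ 2 + (0 * x + t / s * y + 0 * z) ^ 2
        = s ^ 2 * x ^ 2 + 2 * b * x * y + (b ^ 2 + t ^ 2) / s ^ 2 * y ^ 2 := by
      field_simp
      ring
    rw [add_assoc, e, hs2, ht2, hbR]
    have : (4 * q * h : ℝ) / (2 * q) = 2 * h := by
      rw [div_eq_iff hqR.ne']; ring
    rw [this]
    ring
  -- The radius `√(2m)` is large enough because `8 < 2√2 · 4π/3`.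
  obtain ⟨v, hv0, hv⟩ := exists_int_vec_sum_sq_lt M (by rw [hdet]; positivity)
    (r := √2 * t) (by positivity) (by
      rw [hdet, abs_of_pos (by positivity)]
      have h2 : √2 ^ 2 = (2 : ℝ) := Real.sq_sqrt (by norm_num)
      have h2' : (1.4 : ℝ) < √2 := Real.lt_sqrt_of_sq_lt (by norm_num)
      have hpi := Real.pi_gt_three
      have e : (√2 * t) ^ 3 = 2 * √2 * (m * t) := by
        linear_combination (√2 * t ^ 3) * h2 + 2 * √2 * t * ht2
      rw [e]
      have : (8 : ℝ) < 2 * √2 * (Real.pi * 4 / 3) := by nlinarith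
      nlinarith [mul_pos hmR ht0])
  have hvec : (fun j => (v j : ℝ)) = ![(v 0 : ℝ), v 1, v 2] := by
    ext j; fin_cases j <;> rfl
  rw [hvec] at hv
  have hinj : ∑ i, (M *ᵥ ![(v 0 : ℝ), v 1, v 2]) i ^ 2 ≠ 0 := by
    intro h0
    have hz : M *ᵥ ![(v 0 : ℝ), v 1, v 2] = 0 := by
      ext i
      have := (Finset.sum_eq_zero_iff_of_nonneg (fun i _ => sq_nonneg _)).1 h0 i (Finset.mem_univ i)
      simpa using this
    have hz2 := Matrix.eq_zero_of_mulVec_eq_zero (by rw [hdet]; positivity) hz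
    apply hv0
    rw [← hvec] at hz2
    ext j
    have := congrFun hz2 j
    simpa using this
  have hpos : 0 < ∑ i, (M *ᵥ ![(v 0 : ℝ), v 1, v 2]) i ^ 2 :=
    lt_of_le_of_ne (Finset.sum_nonneg fun i _ => sq_nonneg _) hinj.symm
  rw [hsum] at hv hpos
  refine ⟨v 0, v 1, v 2, by exact_mod_cast hpos, ?_⟩
  rw [mul_pow, Real.sq_sqrt (by norm_num), ht2] at hv
  exact_mod_cast hv

/-- Let `p ∣ v`, so `r² ≡ m` modulo `p`. If `p ∤ m`, then `-m` is a nonsquare because `-1` is, and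
the descent lemma applies to `4qv = (2qx + by)² + m y²`. If `p ∣ m`, dividing both relations by `p`
and using `2q ≡ -1` gives `y² ≡ -1`, a contradiction; squarefreeness makes `m / p` invertible modulo
`p`. -/
theorem even_padicValNat_of_ternary {m q : ℕ} (hsq : Squarefree m)
    (hq : q.Prime) (hq4 : q % 4 = 1) (hqm : ((2 * q + 1 : ℕ) : ZMod m) = 0)
    {b h r x y : ℤ} {v : ℕ} (hb : b ^ 2 + m = 4 * q * h)
    (hv : (v : ℤ) = q * x ^ 2 + b * x * y + h * y ^ 2) (hv0 : v ≠ 0)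
    (hr : r ^ 2 + 2 * v = m) {p : ℕ} (hp : p.Prime) (hp4 : p % 4 = 3) :
    Even (padicValNat p v) := by
  have := Fact.mk hp
  have hneg : ¬ IsSquare (-1 : ZMod p) := by
    rw [ZMod.exists_sq_eq_neg_one_iff]; omega
  by_cases hpv : p ∣ v
  swap
  · rw [padicValNat.eq_zero_of_not_dvd hpv]; exact Even.zero
  have hpq : p ≠ q := by rintro rfl; omega
  have hA : (4 * q * v : ℤ) = (2 * q * x + b * y) ^ 2 + m * y ^ 2 := by
    rw [hv]; linear_combination -y ^ 2 * hb
  have hpv0 : (v : ZMod p) = 0 := (ZMod.natCast_eq_zero_iff _ _).2 hpv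
  have hrm : (r : ZMod p) ^ 2 = m := by
    have : ((r ^ 2 + 2 * v : ℤ) : ZMod p) = ((m : ℤ) : ZMod p) := by rw [hr]
    push_cast at this
    rw [hpv0] at this
    simpa using this
  by_cases hpm : p ∣ m
  · exfalso
    have hm0 : (m : ZMod p) = 0 := (ZMod.natCast_eq_zero_iff _ _).2 hpm
    have hr0 : (r : ZMod p) = 0 := by rw [hm0] at hrm; simpa using hrm
    have hA0 : ((2 * q * x + b * y : ℤ) : ZMod p) = 0 := by
      have : ((4 * q * v : ℤ) : ZMod p) = (((2 * q * x + b * y) ^ 2 + m * y ^ 2 : ℤ) : ZMod p) := by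
        rw [hA]
      push_cast at this ⊢
      rw [hpv0, hm0] at this
      simpa using this.symm
    have hq2 : (2 * q + 1 : ZMod p) = 0 := by
      have h1 : m ∣ 2 * q + 1 := (ZMod.natCast_eq_zero_iff _ _).1 hqm
      have := (ZMod.natCast_eq_zero_iff _ p).2 (hpm.trans h1)
      exact_mod_cast this
    obtain ⟨m', rfl⟩ := hpm
    obtain ⟨v', rfl⟩ := hpv
    obtain ⟨r', rfl⟩ := (ZMod.intCast_zmod_eq_zero_iff_dvd r p).1 hr0
    obtain ⟨a', ha'⟩ := (ZMod.intCast_zmod_eq_zero_iff_dvd _ p).1 hA0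
    have hp0 : (p : ℤ) ≠ 0 := by exact_mod_cast hp.ne_zero
    have e1 : p * r' ^ 2 + 2 * v' = (m' : ℤ) := by
      apply mul_left_cancel₀ hp0; push_cast at hr; linear_combination hr
    have e2 : (4 * q * v' : ℤ) = p * a' ^ 2 + m' * y ^ 2 := by
      apply mul_left_cancel₀ hp0; rw [ha'] at hA; push_cast at hA; linear_combination hA
    have f1 : (2 * v' : ZMod p) = m' := by
      have := congrArg (Int.cast : ℤ → ZMod p) e1
      push_cast at this
      simpa using this
    have f2 : (4 * q * v' : ZMod p) = m' * y ^ 2 := by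
      have := congrArg (Int.cast : ℤ → ZMod p) e2
      push_cast at this
      simpa using this
    have hm' : (m' : ZMod p) ≠ 0 := by
      intro h0
      obtain ⟨c, rfl⟩ := (ZMod.natCast_eq_zero_iff _ _).1 h0
      have := hsq p ⟨c, by ring⟩
      exact hp.not_isUnit this
    apply hneg
    refine ⟨y, ?_⟩
    apply mul_left_cancel₀ hm'
    linear_combination f2 - 2 * q * f1 - m' * hq2
  · have hm0 : (m : ZMod p) ≠ 0 := fun h0 => hpm ((ZMod.natCast_eq_zero_iff _ _).1 h0)
    have hr0 : (r : ZMod p) ≠ 0 := by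
      intro h0; rw [h0] at hrm; apply hm0; simpa using hrm.symm
    have hns : ¬ IsSquare (-((m : ℤ) : ZMod p)) := by
      rintro ⟨c, hc⟩
      apply hneg
      refine ⟨c / r, ?_⟩
      push_cast at hc
      field_simp
      linear_combination hc - hrm
    have hne : 4 * q * v ≠ 0 := by
      have := hq.ne_zero
      positivity
    have hev := even_padicValNat_of_eq_sq_add_mul_sq hns (4 * q * v) hne _ _
      (by push_cast; exact hA)
    have h4q : ¬ p ∣ 4 * q := by
      rw [hp.dvd_mul]
      rintro (h | h)
      · have : p ∣ 2 ^ 2 := h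
        have := (Nat.prime_dvd_prime_iff_eq hp Nat.prime_two).1 (hp.dvd_of_dvd_pow this)
        omega
      · exact hpq ((Nat.prime_dvd_prime_iff_eq hp hq).1 h)
    rw [padicValNat.mul (by have := hq.ne_zero; positivity) hv0,
      padicValNat.eq_zero_of_not_dvd h4q, zero_add] at hev
    exact hev

/-- The ternary form takes values divisible by `m`, since `4q ≡ -2` modulo `m`. A value strictly
between 0 and `2m` is thus `m = r² + 2v`, and `2v` is a sum of two squares by Fermat's criterion. -/
theorem exists_sum_three_sq_of_squarefree {m : ℕ} (hm : m % 8 = 3) (hsq : Squarefree m) :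
    ∃ a b c : ℤ, (m : ℤ) = a ^ 2 + b ^ 2 + c ^ 2 := by
  obtain ⟨q, hq, hq4, hqm, hnd⟩ := exists_auxiliary_prime hm
  obtain ⟨b, h, hb⟩ := exists_odd_sq_add_eq hm hq4
    (isSquare_neg_mod_auxiliary_prime hm hq hq4 hqm hnd)
  obtain ⟨x, y, z, hpos, hlt⟩ := exists_small_ternary_value (by omega : 0 < m) hq.pos hb
  set r := 2 * q * x + b * y + m * z with hr
  set w := q * x ^ 2 + b * x * y + h * y ^ 2 with hw
  have hqw : 4 * q * w = (2 * q * x + b * y) ^ 2 + m * y ^ 2 := by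
    rw [hw]; linear_combination -y ^ 2 * hb
  have hq0 : (0 : ℤ) < 4 * q := by have := hq.pos; positivity
  have hw0 : 0 ≤ w := by
    have : 0 ≤ 4 * q * w := by rw [hqw]; positivity
    exact nonneg_of_mul_nonneg_right this hq0
  have hdvd : (m : ℤ) ∣ r ^ 2 + 2 * w := by
    rw [← ZMod.intCast_zmod_eq_zero_iff_dvd]
    have hm0 : (m : ZMod m) = 0 := ZMod.natCast_self m
    have e := congrArg (Int.cast : ℤ → ZMod m) hqw
    have e2 := congrArg (Int.cast : ℤ → ZMod m) hr
    push_cast at e e2 hqm ⊢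
    rw [hm0] at e e2
    rw [e2]
    linear_combination -e + 2 * w * hqm
  have heq : r ^ 2 + 2 * w = m := by
    obtain ⟨k, hk⟩ := hdvd
    rw [hk] at hpos hlt ⊢
    have hmp : (0 : ℤ) < m := by exact_mod_cast (by omega : 0 < m)
    have h1 : 0 < k := pos_of_mul_pos_right hpos hmp.le
    have h2 : k < 2 := by nlinarith
    have : k = 1 := by omega
    rw [this, mul_one]
  obtain ⟨v, hv⟩ := Int.eq_ofNat_of_zero_le hw0
  rw [hv] at heq
  -- Otherwise `m` would be a square congruent to 3 modulo 8.
  have hv0 : v ≠ 0 := by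
    rintro rfl
    simp only [Int.natCast_zero, mul_zero, add_zero] at heq
    have h8 : (m : ℤ) % 8 = 3 := by omega
    rw [← heq] at h8
    have : r ^ 2 % 8 = ((r % 8) ^ 2) % 8 := by rw [pow_two, pow_two, Int.mul_emod]
    rw [this] at h8
    have h9 : 0 ≤ r % 8 := Int.emod_nonneg _ (by norm_num)
    have h10 : r % 8 < 8 := Int.emod_lt_of_pos _ (by norm_num)
    interval_cases r % 8 <;> omega
  obtain ⟨s, t, hst⟩ := (Nat.eq_sq_add_sq_iff (n := 2 * v)).2 (by
    intro p hp hp4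
    have hpp := Nat.prime_of_mem_primeFactors hp
    have := Fact.mk hpp
    rw [padicValNat.mul two_ne_zero hv0]
    have : ¬ p ∣ 2 := by
      intro hd
      have := (Nat.prime_dvd_prime_iff_eq hpp Nat.prime_two).1 hd
      omega
    rw [padicValNat.eq_zero_of_not_dvd this, zero_add]
    exact even_padicValNat_of_ternary hsq hq hq4 hqm hb (hv ▸ hw) hv0 heq hpp hp4)
  refine ⟨r, s, t, ?_⟩
  have : (2 * v : ℤ) = s ^ 2 + t ^ 2 := by exact_mod_cast hst
  rw [← heq, this]
  ring

/-- Numbers congruent to `3` modulo `8` are sums of three squares. -/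
theorem exists_sum_three_sq {n : ℕ} (hn : n % 8 = 3) :
    ∃ a b c : ℤ, (n : ℤ) = a ^ 2 + b ^ 2 + c ^ 2 := by
  obtain ⟨m, t, rfl, hm⟩ := Nat.sq_mul_squarefree n
  -- The square factor is odd, so removing it preserves the class modulo 8.
  have ht : t ^ 2 % 8 = 1 := by
    have h2 : t % 2 = 1 := by
      rcases Nat.mod_two_eq_zero_or_one t with h | h
      · obtain ⟨k, rfl⟩ : ∃ k, t = 2 * k := ⟨t / 2, by omega⟩
        have : (2 * k) ^ 2 * m = 2 * (2 * k ^ 2 * m) := by ring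
        omega
      · exact h
    have h3 : t ^ 2 % 8 = ((t % 8) ^ 2) % 8 := Nat.pow_mod t 2 8
    have h4 : t % 8 = 1 ∨ t % 8 = 3 ∨ t % 8 = 5 ∨ t % 8 = 7 := by omega
    rcases h4 with h | h | h | h <;> (rw [h3, h]; norm_num)
  have hm8 : m % 8 = 3 := by
    rw [Nat.mul_mod, ht, one_mul, Nat.mod_mod] at hn
    exact hn
  obtain ⟨a, b, c, h⟩ := exists_sum_three_sq_of_squarefree hm8 hm
  refine ⟨t * a, t * b, t * c, ?_⟩
  push_cast
  rw [h]
  ring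

/-! ### Rotations: isometry and transitivity on spheres. -/

theorem norm_rot {d : ℕ} (ρ : SO d) (x : E d) : ‖rot ρ x‖ = ‖x‖ := by
  have h : ρ.1ᵀ * ρ.1 = 1 := (Matrix.mem_orthogonalGroup_iff' (A := ρ.1)).1
    (Matrix.mem_specialOrthogonalGroup_iff.1 ρ.2).1
  have h2 : ‖rot ρ x‖ ^ 2 = ‖x‖ ^ 2 := by
    rw [EuclideanSpace.real_norm_sq_eq, EuclideanSpace.real_norm_sq_eq]
    have e : ∀ v : Fin d → ℝ, ∑ i, v i ^ 2 = v ⬝ᵥ v := fun v => by simp [dotProduct, sq]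
    change ∑ i, (ρ.1 *ᵥ x.ofLp) i ^ 2 = ∑ i, x.ofLp i ^ 2
    rw [e, e, Matrix.dotProduct_mulVec, Matrix.vecMul_mulVec, h, Matrix.vecMul_one]
  exact (sq_eq_sq₀ (norm_nonneg _) (norm_nonneg _)).1 h2

/-- A rotation as a linear isometry equivalence. -/
noncomputable def rotIsometry {d : ℕ} (ρ : SO d) : E d ≃ₗᵢ[ℝ] E d :=
  LinearIsometry.toLinearIsometryEquiv
    { toFun := rot ρ
      map_add' := fun x y => by simp [rot, Matrix.mulVec_add]
      map_smul' := fun c x => by simp [rot, Matrix.mulVec_smul]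
      norm_map' := norm_rot ρ } rfl

theorem rotIsometry_apply {d : ℕ} (ρ : SO d) (x : E d) : rotIsometry ρ x = rot ρ x := rfl

theorem exists_rot_eq_isometry {d : ℕ} (U : E d ≃ₗᵢ[ℝ] E d)
    (hU : LinearMap.det (U.toLinearEquiv : E d →ₗ[ℝ] E d) = 1) : ∃ ρ : SO d, ∀ x, rot ρ x = U x := by
  let b := EuclideanSpace.basisFun (Fin d) ℝ
  let M := LinearMap.toMatrix b.toBasis b.toBasis (U.toLinearEquiv : E d →ₗ[ℝ] E d)
  have hM : M ∈ Matrix.orthogonalGroup (Fin d) ℝ := U.toMatrix_mem_unitaryGroup b b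
  have hdet : M.det = 1 := by rw [LinearMap.det_toMatrix, hU]
  refine ⟨⟨M, Matrix.mem_specialOrthogonalGroup_iff.2 ⟨hM, hdet⟩⟩, fun x => ?_⟩
  have h := LinearMap.toMatrix_mulVec_repr b.toBasis b.toBasis
    (U.toLinearEquiv : E d →ₗ[ℝ] E d) x
  ext i
  have := congrFun h i
  have hx : (b.toBasis.repr x : Fin d → ℝ) = x.ofLp := by ext j; simp [b]
  rw [hx] at this
  simpa [b, rot, M] using this

/-- The reflection exchanging `ξ` and `η` has determinant `-1`. A second reflection, along some `w ⟂
η`, fixes `η` and restores determinant 1. -/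
theorem exists_rot_eq {d : ℕ} (hd : 2 ≤ d) {ξ η : E d} (h : ‖ξ‖ = ‖η‖) :
    ∃ ρ : SO d, rot ρ ξ = η := by
  by_cases hne : ξ = η
  · obtain ⟨ρ, hρ⟩ := exists_rot_eq_isometry (LinearIsometryEquiv.refl ℝ (E d)) (by
      exact LinearMap.det_id)
    exact ⟨ρ, by rw [hρ, ← hne]; rfl⟩
  have hdet : ∀ v : E d, v ≠ 0 →
      LinearMap.det ((ℝ ∙ v)ᗮ.reflection.toLinearEquiv : E d →ₗ[ℝ] E d) = -1 := by
    intro v hv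
    have := Submodule.det_reflection (𝕜 := ℝ) ((ℝ ∙ v)ᗮ)
    rw [Submodule.orthogonal_orthogonal, finrank_span_singleton hv, pow_one] at this
    exact this
  obtain ⟨w, hw, hw0⟩ : ∃ w ∈ (ℝ ∙ η)ᗮ, w ≠ 0 := by
    apply Submodule.exists_mem_ne_zero_of_ne_bot
    intro hbot
    have h1 := Submodule.finrank_add_finrank_orthogonal (ℝ ∙ η)
    have h2 : Module.finrank ℝ (ℝ ∙ η) ≤ 1 :=
      (finrank_span_le_card ({η} : Set (E d))).trans (by simp)
    rw [hbot, finrank_bot, finrank_euclideanSpace_fin] at h1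
    omega
  obtain ⟨ρ, hρ⟩ := exists_rot_eq_isometry
    ((ℝ ∙ (ξ - η))ᗮ.reflection.trans (ℝ ∙ w)ᗮ.reflection) (by
      have : (((ℝ ∙ (ξ - η))ᗮ.reflection.trans (ℝ ∙ w)ᗮ.reflection).toLinearEquiv : E d →ₗ[ℝ] E d)
        = ((ℝ ∙ w)ᗮ.reflection.toLinearEquiv : E d →ₗ[ℝ] E d) ∘ₗ
          ((ℝ ∙ (ξ - η))ᗮ.reflection.toLinearEquiv : E d →ₗ[ℝ] E d) := rfl
      rw [this, LinearMap.det_comp, hdet _ hw0, hdet _ (sub_ne_zero.2 hne)]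
      norm_num)
  refine ⟨ρ, ?_⟩
  rw [hρ, LinearIsometryEquiv.trans_apply, Submodule.reflection_sub h]
  apply Submodule.reflection_mem_subspace_eq_self
  rw [Submodule.mem_orthogonal_singleton_iff_inner_right] at hw ⊢
  rw [real_inner_comm]; exact hw

/-! ### Vanishing of the Fourier transform on spheres. -/

theorem inner_latticePt {d : ℕ} (ν m : Fin d → ℤ) :
    ⟪latticePt ν, latticePt m⟫ = ((∑ i, ν i * m i : ℤ) : ℝ) := by
  simp [latticePt, PiLp.inner_apply, mul_comm]

/-- The Fourier transform of a function with vanishing `ℤ^d`-periodization vanishes on `ℤ^d`. -/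
theorem fourier_latticePt_eq_zero {d : ℕ} {F : E d → ℂ} (hF : Integrable F)
    (h : ∀ᵐ x, ∑' ν : Fin d → ℤ, F (x - latticePt ν) = 0) (m : Fin d → ℤ) :
    𝓕 F (latticePt m) = 0 := by
  let b := (EuclideanSpace.basisFun (Fin d) ℝ).toBasis
  let L := (Submodule.span ℤ (Set.range b))
  have hfd : IsAddFundamentalDomain L (ZSpan.fundamentalDomain b) (volume : Measure (E d)) :=
    ZSpan.isAddFundamentalDomain b volume
  have : VAddInvariantMeasure L (E d) volume :=
    inferInstanceAs (VAddInvariantMeasure L.toAddSubgroup (E d) volume)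
  -- The negation matches translation by a lattice element with the shift `x - ν` in the
  -- periodization.
  let e : (Fin d → ℤ) ≃ L := ((b.restrictScalars ℤ).equivFun.symm).toEquiv.trans (Equiv.neg L)
  have he : ∀ ν, ((e ν : L) : E d) = -latticePt ν := by
    intro ν
    have : (((b.restrictScalars ℤ).equivFun.symm ν : L) : E d) = latticePt ν := by
      rw [Module.Basis.equivFun_symm_apply]
      ext i
      rw [Submodule.coe_sum, WithLp.ofLp_sum, Finset.sum_apply]
      have hj : ∀ j, ((ν j • b.restrictScalars ℤ j : L) : E d) = (ν j : ℝ) • b j := fun j => by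
        rw [Submodule.coe_smul, Module.Basis.restrictScalars_apply, Int.cast_smul_eq_zsmul]
      simp only [hj]
      simp [latticePt, b]
    change ((-((b.restrictScalars ℤ).equivFun.symm ν) : L) : E d) = _
    rw [Submodule.coe_neg, this]
  -- The character is `ℤ^d`-periodic, so unfolding the Fourier integral over a fundamental domain
  -- leaves the character times the periodization of `F`, which is zero.
  set G : E d → ℂ := fun x => Real.fourierChar (-⟪x, latticePt m⟫) • F x with hG
  have hGi : Integrable G := by
    simpa [hG] using (Real.fourierIntegral_convergent_iff (latticePt m)).2 hF
  have htrans : ∀ ν x, G (e ν +ᵥ x) = Real.fourierChar (-⟪x, latticePt m⟫) • F (x - latticePt ν) := by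
    intro ν x
    have hv : (e ν +ᵥ x : E d) = x - latticePt ν := by
      rw [Submodule.vadd_def, he, vadd_eq_add]; abel
    rw [hv, hG]
    simp only [inner_sub_left, inner_latticePt]
    congr 1
    rw [show -(⟪x, latticePt m⟫ - ((∑ i, ν i * m i : ℤ) : ℝ)) =
      -⟪x, latticePt m⟫ + ((∑ i, ν i * m i : ℤ) : ℝ) by ring, AddChar.map_add_eq_mul]
    have : Real.fourierChar (((∑ i, ν i * m i : ℤ) : ℝ)) = 1 := by
      ext
      rw [Real.fourierChar_apply]
      rw [Circle.coe_one, Complex.exp_eq_one_iff]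
      exact ⟨∑ i, ν i * m i, by push_cast; ring⟩
    rw [this, mul_one]
  have hint : ∀ ν, IntegrableOn (fun x => G (e ν +ᵥ x)) (ZSpan.fundamentalDomain b) := by
    intro ν
    have : (fun x => G (e ν +ᵥ x)) = fun x => G (-latticePt ν + x) := by
      ext x; rw [Submodule.vadd_def, he, vadd_eq_add]
    rw [this]
    exact (hGi.comp_add_left (-latticePt ν)).integrableOn
  have hsum : Summable fun ν => ∫ x in ZSpan.fundamentalDomain b, ‖G (e ν +ᵥ x)‖ := by
    have hne : ∑' g : L, ∫⁻ x in ZSpan.fundamentalDomain b, ‖G (g +ᵥ x)‖ₑ ≠ ∞ := by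
      rw [← hfd.lintegral_eq_tsum'' (fun x => ‖G x‖ₑ)]
      exact hGi.2.ne
    rw [← e.tsum_eq] at hne
    refine (ENNReal.summable_toReal hne).congr fun ν => ?_
    rw [integral_norm_eq_lintegral_enorm (hint ν).1]
  have h1 := hfd.integral_eq_tsum'' G hGi
  rw [← e.tsum_eq] at h1
  rw [(hasSum_integral_of_summable_integral_norm hint hsum).tsum_eq] at h1
  have h2 : ∫ x in ZSpan.fundamentalDomain b, ∑' ν, G (e ν +ᵥ x) = 0 := by
    apply integral_eq_zero_of_ae
    filter_upwards [ae_restrict_of_ae h] with x hx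
    simp only [htrans, Pi.zero_apply, Circle.smul_def]
    rw [tsum_const_smul'', hx, smul_zero]
  rw [Real.fourier_eq]
  exact h1.trans h2

/-- The Fourier transform of a function with vanishing periodizations vanishes on every sphere
centred at the origin that contains a lattice point. -/
theorem fourier_eq_zero_of_norm_eq {d : ℕ} (hd : 2 ≤ d) {f : E d → ℂ} (hf : Integrable f)
    (h : HasVanishingPeriodizations f) (m : Fin d → ℤ) {ξ : E d} (hξ : ‖ξ‖ = ‖latticePt m‖) :
    𝓕 f ξ = 0 := by
  have hae : ∀ᵐ ρ ∂(Measure.haar : Measure (SO d)), 𝓕 f (rot ρ (latticePt m)) = 0 := by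
    filter_upwards [h] with ρ hρ
    have hi : Integrable (f ∘ rotIsometry ρ) :=
      ((rotIsometry ρ).measurePreserving.integrable_comp_emb
        (rotIsometry ρ).toHomeomorph.measurableEmbedding).2 hf
    rw [← rotIsometry_apply, ← Real.fourier_comp_linearIsometry]
    exact fourier_latticePt_eq_zero hi hρ m
  have hcF : Continuous (𝓕 f) :=
    VectorFourier.fourierIntegral_continuous Real.continuous_fourierChar
      (by exact continuous_inner) hf
  have hcr : Continuous fun ρ : SO d => rot ρ (latticePt m) :=
    (PiLp.continuous_toLp 2 _).comp
      (continuous_subtype_val.matrix_mulVec continuous_const)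
  -- Haar measure charges every nonempty open set, so continuity in `ρ` upgrades almost every
  -- rotation to every rotation.
  have hall : (fun ρ : SO d => 𝓕 f (rot ρ (latticePt m))) = fun _ => 0 :=
    Continuous.ae_eq_iff_eq (Measure.haar : Measure (SO d)) (hcF.comp hcr) continuous_const |>.1 hae
  obtain ⟨ρ, hρ⟩ := exists_rot_eq hd hξ.symm
  rw [← hρ]
  exact congrFun hall ρ

/-- The Fourier transform of a function with vanishing periodizations vanishes on the spheres
whose squared radius is `3` modulo `8`. -/
theorem fourier_eq_zero_of_norm_sq_eq {d : ℕ} (hd : 3 ≤ d) {f : E d → ℂ} (hf : Integrable f)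
    (h : HasVanishingPeriodizations f) {n : ℕ} (hn : n % 8 = 3) {ξ : E d} (hξ : ‖ξ‖ ^ 2 = n) :
    𝓕 f ξ = 0 := by
  obtain ⟨a, b, c, habc⟩ := exists_sum_three_sq hn
  obtain ⟨k, rfl⟩ : ∃ k, d = 3 + k := ⟨d - 3, by omega⟩
  -- The three squares are padded with zeros to a lattice point of `ℤ^d`.
  refine fourier_eq_zero_of_norm_eq (by omega) hf h (Fin.append ![a, b, c] 0) ?_
  have : ‖(latticePt (Fin.append ![a, b, c] 0) : E (3 + k))‖ ^ 2 = n := by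
    rw [EuclideanSpace.real_norm_sq_eq, Fin.sum_univ_add]
    have e : (n : ℝ) = a ^ 2 + b ^ 2 + c ^ 2 := by exact_mod_cast habc
    simp [latticePt, Fin.sum_univ_three, e]
  rw [← this] at hξ
  exact (sq_eq_sq₀ (norm_nonneg _) (norm_nonneg _)).1 hξ

/-! ### Gaussian multipliers: kernel, `L¹ → L^∞` and `L²` bounds. -/

section GaussianKernel

variable {V : Type*} [NormedAddCommGroup V] [InnerProductSpace ℝ V]

/-- The convolution kernel of `gaussOp`. -/
noncomputable def gaussKernel (z : ℂ) (x : V) : ℂ :=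
  (Real.pi / z) ^ (Module.finrank ℝ V / 2 : ℂ) * Complex.exp (-Real.pi ^ 2 * ‖x‖ ^ 2 / z)

/-- `Re (1/z) ≥ 0`, so only the prefactor contributes. The bound depends on `|z|` alone and survives
`Re z → 0`. -/
theorem norm_gaussKernel_le {z : ℂ} (hz : 0 < z.re) (x : V) :
    ‖gaussKernel z x‖ ≤ (Real.pi / ‖z‖) ^ (Module.finrank ℝ V / 2 : ℝ) := by
  have hz0 : z ≠ 0 := by rintro rfl; simp at hz
  rw [gaussKernel, norm_mul]
  have h1 : ‖((Real.pi : ℂ) / z) ^ (Module.finrank ℝ V / 2 : ℂ)‖ =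
      (Real.pi / ‖z‖) ^ (Module.finrank ℝ V / 2 : ℝ) := by
    have e : (Module.finrank ℝ V / 2 : ℂ) = ((Module.finrank ℝ V / 2 : ℝ) : ℂ) := by push_cast; rfl
    rw [e, Complex.norm_cpow_real, norm_div, Complex.norm_real, Real.norm_of_nonneg Real.pi_pos.le]
  rw [h1]
  refine mul_le_of_le_one_right (by positivity) ?_
  rw [Complex.norm_exp]
  apply Real.exp_le_one_iff.2
  have e : (-Real.pi ^ 2 * ‖x‖ ^ 2 / z : ℂ) = ((-(Real.pi ^ 2 * ‖x‖ ^ 2) : ℝ) : ℂ) * z⁻¹ := by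
    push_cast; ring
  rw [e, Complex.re_ofReal_mul, Complex.inv_re]
  have : 0 ≤ z.re / Complex.normSq z := div_nonneg hz.le (Complex.normSq_nonneg z)
  nlinarith [mul_nonneg (mul_nonneg (sq_nonneg Real.pi) (sq_nonneg ‖x‖)) this]

theorem continuous_gaussKernel (z : ℂ) : Continuous (gaussKernel (V := V) z) := by
  unfold gaussKernel
  fun_prop

end GaussianKernel

section GaussianMultiplier

variable {V : Type*} [NormedAddCommGroup V] [InnerProductSpace ℝ V] [FiniteDimensional ℝ V]
  [MeasurableSpace V] [BorelSpace V]

theorem continuous_fourier {f : V → ℂ} (hf : Integrable f) : Continuous (𝓕 f) :=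
  VectorFourier.fourierIntegral_continuous Real.continuous_fourierChar
    (by exact continuous_inner) hf

theorem continuous_fourierInv {f : V → ℂ} (hf : Integrable f) : Continuous (𝓕⁻ f) := by
  have : 𝓕⁻ f = fun x => 𝓕 f (-x) := funext fun x => Real.fourierInv_eq_fourier_neg f x
  rw [this]
  exact (continuous_fourier hf).comp continuous_neg

theorem norm_fourier_le (f : V → ℂ) (ξ : V) : ‖𝓕 f ξ‖ ≤ ∫ x, ‖f x‖ :=
  VectorFourier.norm_fourierIntegral_le_integral_norm _ _ _ _ _

/-- The `L²` Fourier transform of an integrable function is given by the Fourier integral. -/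
theorem coeFn_fourier_toLp {f : V → ℂ} (hf : Integrable f) (hf2 : MemLp f 2) :
    (𝓕 (hf2.toLp f) : Lp ℂ 2 (volume : Measure V)) =ᵐ[volume] 𝓕 f := by
  have hloc : LocallyIntegrable ((𝓕 (hf2.toLp f) : Lp ℂ 2 (volume : Measure V)) : V → ℂ) volume :=
    (Lp.memLp _).locallyIntegrable (by norm_num)
  -- Both functions are tested against smooth compactly supported `g`. The transform moves onto `g`
  -- on either side: by tempered distributions for the `L²` version, by Fubini for the integral.
  refine ae_eq_of_integral_contDiff_smul_eq hloc ((continuous_fourier hf).locallyIntegrable (μ := volume)) ?_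
  intro g hg hgc
  have hg₁ : HasCompactSupport (Complex.ofRealCLM ∘ g) := hgc.comp_left rfl
  have hg₂ : ContDiff ℝ (⊤ : ℕ∞) (Complex.ofRealCLM ∘ g) := by fun_prop
  set φ : SchwartzMap V ℂ := hg₁.toSchwartzMap hg₂
  have h1 := congrArg (fun D => D φ) (Lp.fourier_toTemperedDistribution_eq (hf2.toLp f))
  simp only [TemperedDistribution.fourier_apply, Lp.toTemperedDistribution_apply] at h1
  have h2 : ∫ x, (𝓕 φ) x • (hf2.toLp f) x = ∫ x, f x • (𝓕 φ) x := by
    refine integral_congr_ae ?_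
    filter_upwards [hf2.coeFn_toLp] with x hx
    rw [hx, smul_eq_mul, smul_eq_mul, mul_comm]
  have h3 : ∫ x, 𝓕 f x • φ x = ∫ x, f x • 𝓕 (φ : V → ℂ) x :=
    VectorFourier.integral_fourierIntegral_smul_eq_flip (L := innerₗ V)
      Real.continuous_fourierChar continuous_inner hf φ.integrable |>.trans (by
        rw [flip_innerₗ]; rfl)
  have h4 : ∫ x, g x • 𝓕 f x = ∫ x, 𝓕 f x • φ x := by
    refine integral_congr_ae (.of_forall fun x => ?_)
    simp [φ, mul_comm]
  have h5 : ∫ x, g x • (𝓕 (hf2.toLp f) : Lp ℂ 2 (volume : Measure V)) x =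
      ∫ x, φ x • (𝓕 (hf2.toLp f) : Lp ℂ 2 (volume : Measure V)) x := by
    refine integral_congr_ae (.of_forall fun x => ?_)
    simp [φ]
  rw [h5, h4, h3, ← h1, h2, SchwartzMap.fourier_coe]

/-- Plancherel's theorem for `L¹ ∩ L²`. -/
theorem eLpNorm_two_fourier {f : V → ℂ} (hf : Integrable f) (hf2 : MemLp f 2) :
    eLpNorm (𝓕 f) 2 volume = eLpNorm f 2 volume := by
  rw [← eLpNorm_congr_ae (coeFn_fourier_toLp hf hf2), ← eLpNorm_congr_ae hf2.coeFn_toLp,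
    ← Lp.enorm_def, ← Lp.enorm_def, ← ofReal_norm, ← ofReal_norm, Lp.norm_fourier_eq]

theorem eLpNorm_two_fourierInv {f : V → ℂ} (hf : Integrable f) (hf2 : MemLp f 2) :
    eLpNorm (𝓕⁻ f) 2 volume = eLpNorm f 2 volume := by
  have : 𝓕⁻ f = 𝓕 f ∘ (LinearIsometryEquiv.neg ℝ : V ≃ₗᵢ[ℝ] V) :=
    funext fun x => Real.fourierInv_eq_fourier_neg f x
  rw [this, eLpNorm_comp_measurePreserving (continuous_fourier hf).aestronglyMeasurable
    (LinearIsometryEquiv.neg ℝ : V ≃ₗᵢ[ℝ] V).measurePreserving, eLpNorm_two_fourier hf hf2]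

theorem integrable_cexp_neg_mul_sq {z : ℂ} (hz : 0 < z.re) :
    Integrable fun ξ : V => Complex.exp (-z * ‖ξ‖ ^ 2) := by
  simpa using GaussianFourier.integrable_cexp_neg_mul_sq_norm_add hz 0 (0 : V)

theorem integrable_cexp_neg_mul_sq_mul_fourier {z : ℂ} (hz : 0 < z.re) {f : V → ℂ}
    (hf : Integrable f) : Integrable fun ξ : V => Complex.exp (-z * ‖ξ‖ ^ 2) * 𝓕 f ξ :=
  (integrable_cexp_neg_mul_sq hz).mul_bdd (c := ∫ x, ‖f x‖)
    (continuous_fourier hf).aestronglyMeasurable (.of_forall (norm_fourier_le f))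

/-- The Fourier multiplier operator with symbol `exp (-z ‖ξ‖²)`. -/
noncomputable def gaussOp (z : ℂ) (f : V → ℂ) : V → ℂ :=
  𝓕⁻ fun ξ : V => Complex.exp (-z * ‖ξ‖ ^ 2) * 𝓕 f ξ

theorem continuous_gaussOp {z : ℂ} (hz : 0 < z.re) {f : V → ℂ} (hf : Integrable f) :
    Continuous (gaussOp z f) :=
  continuous_fourierInv (integrable_cexp_neg_mul_sq_mul_fourier hz hf)

theorem gaussOp_eq_integral (z : ℂ) (f : V → ℂ) (x : V) :
    gaussOp z f x =
      ∫ ξ, Complex.exp (-z * ‖ξ‖ ^ 2 + 2 * Real.pi * Complex.I * ⟪x, ξ⟫) * 𝓕 f ξ := by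
  rw [gaussOp, Real.fourierInv_eq']
  refine integral_congr_ae (.of_forall fun ξ => ?_)
  simp only [smul_eq_mul]
  rw [← mul_assoc, ← Complex.exp_add, real_inner_comm]
  congr 2
  push_cast
  ring

/-- The multiplication formula moves the Fourier transform from `f` to the modulated Gaussian, where
it is explicit. -/
theorem gaussOp_eq_integral_kernel {z : ℂ} (hz : 0 < z.re) {f : V → ℂ} (hf : Integrable f)
    (x : V) : gaussOp z f x = ∫ y, f y * gaussKernel z (x - y) := by
  have hg : Integrable fun ξ : V =>
      Complex.exp (-z * ‖ξ‖ ^ 2 + 2 * Real.pi * Complex.I * ⟪x, ξ⟫) :=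
    GaussianFourier.integrable_cexp_neg_mul_sq_norm_add hz _ x
  have h := VectorFourier.integral_fourierIntegral_smul_eq_flip (L := innerₗ V)
      Real.continuous_fourierChar continuous_inner hf hg
  rw [flip_innerₗ] at h
  rw [gaussOp_eq_integral]
  refine Eq.trans ?_ (h.trans ?_)
  · exact integral_congr_ae (.of_forall fun ξ => mul_comm _ _)
  · refine integral_congr_ae (.of_forall fun y => ?_)
    simp only [smul_eq_mul, gaussKernel]
    congr 1
    exact fourier_gaussian_innerProductSpace' hz x y

theorem gaussOp_congr_ae {z : ℂ} (hz : 0 < z.re) {f g : V → ℂ} (hf : Integrable f)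
    (h : f =ᵐ[volume] g) : gaussOp z f = gaussOp z g := by
  ext x
  rw [gaussOp_eq_integral_kernel hz hf, gaussOp_eq_integral_kernel hz (hf.congr h)]
  refine integral_congr_ae ?_
  filter_upwards [h] with y hy
  rw [hy]

theorem integrable_mul_gaussKernel {z : ℂ} (hz : 0 < z.re) {f : V → ℂ} (hf : Integrable f)
    (x : V) : Integrable fun y => f y * gaussKernel z (x - y) :=
  hf.mul_bdd (c := (Real.pi / ‖z‖) ^ (Module.finrank ℝ V / 2 : ℝ))
    ((continuous_gaussKernel z).comp (continuous_const.sub continuous_id)).aestronglyMeasurable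
    (.of_forall fun y => norm_gaussKernel_le hz (x - y))

theorem gaussOp_add {z : ℂ} (hz : 0 < z.re) {f g : V → ℂ} (hf : Integrable f)
    (hg : Integrable g) (x : V) : gaussOp z (f + g) x = gaussOp z f x + gaussOp z g x := by
  rw [gaussOp_eq_integral_kernel hz hf, gaussOp_eq_integral_kernel hz hg,
    gaussOp_eq_integral_kernel hz (hf.add hg),
    ← integral_add (integrable_mul_gaussKernel hz hf x) (integrable_mul_gaussKernel hz hg x)]
  simp [add_mul]

theorem norm_gaussOp_le {z : ℂ} (hz : 0 < z.re) {f : V → ℂ} (hf : Integrable f) (x : V) :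
    ‖gaussOp z f x‖ ≤ (Real.pi / ‖z‖) ^ (Module.finrank ℝ V / 2 : ℝ) * ∫ y, ‖f y‖ := by
  rw [gaussOp_eq_integral_kernel hz hf, ← integral_const_mul]
  refine norm_integral_le_of_norm_le (hf.norm.const_mul _) (.of_forall fun y => ?_)
  rw [norm_mul, mul_comm]
  gcongr
  exact norm_gaussKernel_le hz _

theorem enorm_gaussOp_le {z : ℂ} (hz : 0 < z.re) {f : V → ℂ} (hf : Integrable f) (x : V) :
    ‖gaussOp z f x‖ₑ ≤
      ENNReal.ofReal ((Real.pi / ‖z‖) ^ (Module.finrank ℝ V / 2 : ℝ)) * eLpNorm f 1 := by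
  have h := ENNReal.ofReal_le_ofReal (norm_gaussOp_le hz hf x)
  rw [ENNReal.ofReal_mul (by positivity), ofReal_norm,
    ofReal_integral_norm_eq_lintegral_enorm hf] at h
  rwa [eLpNorm_one_eq_lintegral_enorm]

/-- Plancherel, with a symbol of modulus at most 1. -/
theorem eLpNorm_two_gaussOp_le {z : ℂ} (hz : 0 < z.re) {f : V → ℂ} (hf : Integrable f) :
    eLpNorm (gaussOp z f) 2 ≤ eLpNorm f 2 := by
  by_cases h : eLpNorm f 2 = ∞
  · rw [h]; exact le_top
  have hf2 : MemLp f 2 := ⟨hf.1, lt_top_iff_ne_top.2 h⟩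
  have hle : ∀ ξ : V, ‖Complex.exp (-z * ‖ξ‖ ^ 2) * 𝓕 f ξ‖ ≤ ‖𝓕 f ξ‖ := by
    intro ξ
    rw [norm_mul]
    refine mul_le_of_le_one_left (norm_nonneg _) ?_
    rw [Complex.norm_exp]
    apply Real.exp_le_one_iff.2
    have e : (-z * ‖ξ‖ ^ 2 : ℂ) = ((-(‖ξ‖ ^ 2) : ℝ) : ℂ) * z := by push_cast; ring
    rw [e, Complex.re_ofReal_mul]
    nlinarith [mul_nonneg (sq_nonneg ‖ξ‖) hz.le]
  have hi := integrable_cexp_neg_mul_sq_mul_fourier hz hf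
  have hF2 : MemLp (𝓕 f) 2 := ⟨(continuous_fourier hf).aestronglyMeasurable, by
    rw [eLpNorm_two_fourier hf hf2]; exact hf2.2⟩
  rw [gaussOp, eLpNorm_two_fourierInv hi (hF2.mono hi.1 (.of_forall hle)),
    ← eLpNorm_two_fourier hf hf2]
  exact eLpNorm_mono hle

end GaussianMultiplier

/-! ### Real interpolation with explicit dependence on the `L¹ → L^∞` norm. -/

section Interpolation

theorem lintegral_Ioc_rpow {τ s : ℝ} (hτ : 0 ≤ τ) (hs : -1 < s) :
    ∫⁻ t in Set.Ioc 0 τ, ENNReal.ofReal (t ^ s) = ENNReal.ofReal (τ ^ (s + 1) / (s + 1)) := by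
  rw [← ofReal_integral_eq_lintegral_ofReal]
  · rw [← intervalIntegral.integral_of_le hτ, integral_rpow (Or.inl hs),
      Real.zero_rpow (by linarith), sub_zero]
  · exact (intervalIntegrable_iff_integrableOn_Ioc_of_le hτ).1
      (intervalIntegral.intervalIntegrable_rpow' hs)
  · filter_upwards [ae_restrict_mem measurableSet_Ioc] with t ht
    exact Real.rpow_nonneg ht.1.le _

/-- The `t`-integral in the layer-cake formula, over `0 < t ≤ K / a^{p-1}`. It converges at 0
because `q > 2`, and `(p - 1)(q - 2) = 2 - p` turns `a²` into `a^p`. -/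
theorem lintegral_truncated_rpow_le {p q K a : ℝ} (hpq : p.HolderConjugate q) (hp2 : p < 2)
    (hK : 0 < K) (ha : 0 ≤ a) :
    ∫⁻ t in Set.Ioi (0 : ℝ), ({s : ℝ | s * a ^ (p - 1) ≤ K}.indicator
      (fun s => ENNReal.ofReal (a ^ 2) * ENNReal.ofReal (4 * s ^ (q - 3))) t) ≤
      ENNReal.ofReal (4 / (q - 2) * K ^ (q - 2) * a ^ p) := by
  have hp1 := hpq.sub_one_pos
  have hq2 : 0 < q - 2 := by
    have h := hpq.sub_one_mul_conj
    nlinarith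
  rcases ha.eq_or_lt with rfl | ha
  · simp
  have hap : 0 < a ^ (p - 1) := Real.rpow_pos_of_pos ha _
  have hset : MeasurableSet {s : ℝ | s * a ^ (p - 1) ≤ K} :=
    measurableSet_le (by fun_prop) measurable_const
  rw [← lintegral_indicator measurableSet_Ioi]
  have e : (Set.Ioi (0 : ℝ)).indicator ({s : ℝ | s * a ^ (p - 1) ≤ K}.indicator
      (fun s => ENNReal.ofReal (a ^ 2) * ENNReal.ofReal (4 * s ^ (q - 3)))) =
      (Set.Ioc 0 (K / a ^ (p - 1))).indicator
        (fun s => ENNReal.ofReal (4 * a ^ 2) * ENNReal.ofReal (s ^ (q - 3))) := by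
    have hS : Set.Ioi (0 : ℝ) ∩ {s : ℝ | s * a ^ (p - 1) ≤ K} = Set.Ioc 0 (K / a ^ (p - 1)) := by
      ext s
      simp [le_div_iff₀ hap]
    rw [Set.indicator_indicator, hS]
    refine Set.indicator_congr fun s hs => ?_
    rw [← ENNReal.ofReal_mul (by positivity), ← ENNReal.ofReal_mul (by positivity)]
    ring_nf
  rw [e, lintegral_indicator measurableSet_Ioc, lintegral_const_mul' _ _ ENNReal.ofReal_ne_top,
    lintegral_Ioc_rpow (by positivity) (by linarith), ← ENNReal.ofReal_mul (by positivity)]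
  apply ENNReal.ofReal_le_ofReal
  apply le_of_eq
  rw [show q - 3 + 1 = q - 2 by ring, Real.div_rpow hK.le hap.le, ← Real.rpow_mul ha.le]
  have h2 : a ^ 2 = a ^ p * a ^ ((p - 1) * (q - 2)) := by
    rw [← Real.rpow_add ha, ← Real.rpow_natCast]
    congr 1
    have h := hpq.sub_one_mul_conj
    push_cast
    linarith
  rw [h2]
  have : a ^ ((p - 1) * (q - 2)) ≠ 0 := (Real.rpow_pos_of_pos ha _).ne'
  field_simp

variable {α β : Type*} [MeasurableSpace α] [MeasurableSpace β] {μ : Measure α} {ν : Measure β}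

/-- With `A = ∫ |f|^p`, the part of `f` where `t |f|^{p-1} > 2MA` has `L¹` norm at most `t/(2M)`, so
`T` sends it below `t/2` everywhere. Chebyshev in `L²` at height `t/2` handles the rest, whence the
factor `4/t²`. -/
theorem meas_norm_gt_le_of_weak_bounds {T : (α → ℂ) → β → ℂ} {M : ℝ} (hM : 0 < M)
    (hmeas : ∀ f, Integrable f μ → AEStronglyMeasurable (T f) ν)
    (hadd : ∀ f g, Integrable f μ → Integrable g μ → ∀ x, T (f + g) x = T f x + T g x)
    (h1 : ∀ f, Integrable f μ → ∀ x, ‖T f x‖ₑ ≤ ENNReal.ofReal M * eLpNorm f 1 μ)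
    (h2 : ∀ f, Integrable f μ → eLpNorm (T f) 2 ν ≤ eLpNorm f 2 μ)
    {p : ℝ} (hp : 1 < p) {f : α → ℂ} (hf : Integrable f μ)
    (hfm : StronglyMeasurable f) (hfp : Integrable (fun x => ‖f x‖ ^ p) μ)
    (hA : 0 < ∫ x, ‖f x‖ ^ p ∂μ) {t : ℝ} (ht : 0 < t) :
    ν {x | t < ‖T f x‖} ≤ ENNReal.ofReal (4 / t ^ 2) *
      ∫⁻ x, {x | t * ‖f x‖ ^ (p - 1) ≤ 2 * M * ∫ y, ‖f y‖ ^ p ∂μ}.indicator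
        (fun x => ENNReal.ofReal (‖f x‖ ^ 2)) x ∂μ := by
  set A := ∫ x, ‖f x‖ ^ p ∂μ with hAdef
  set S := {x | t * ‖f x‖ ^ (p - 1) ≤ 2 * M * A} with hS
  have hSm : MeasurableSet S :=
    measurableSet_le ((hfm.norm.measurable.pow_const _).const_mul t) measurable_const
  have hsplit : f = S.indicator f + Sᶜ.indicator f := (Set.indicator_self_add_compl S f).symm
  have hi1 := hf.indicator hSm
  have hi2 := hf.indicator hSm.compl
  have hbig : ∀ x, ‖T (Sᶜ.indicator f) x‖ ≤ t / 2 := by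
    intro x
    have hle : eLpNorm (Sᶜ.indicator f) 1 μ ≤ ENNReal.ofReal (t / (2 * M)) := by
      rw [eLpNorm_one_eq_lintegral_enorm]
      calc ∫⁻ x, ‖Sᶜ.indicator f x‖ₑ ∂μ
          ≤ ∫⁻ x, ENNReal.ofReal (t / (2 * M * A) * ‖f x‖ ^ p) ∂μ := by
            refine lintegral_mono fun x => ?_
            by_cases hx : x ∈ S
            · simp [hx]
            · rw [Set.indicator_of_mem (show x ∈ Sᶜ from hx), ← ofReal_norm]
              apply ENNReal.ofReal_le_ofReal
              have hx' : 2 * M * A < t * ‖f x‖ ^ (p - 1) := not_le.1 hx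
              have hpow : ‖f x‖ ^ p = ‖f x‖ * ‖f x‖ ^ (p - 1) := by
                rw [← Real.rpow_one_add' (norm_nonneg _) (by linarith)]
                congr 1; ring
              rw [hpow, div_mul_eq_mul_div, le_div_iff₀ (by positivity)]
              nlinarith [norm_nonneg (f x), mul_le_mul_of_nonneg_left hx'.le (norm_nonneg (f x))]
        _ = ENNReal.ofReal (t / (2 * M)) := by
            rw [← ofReal_integral_eq_lintegral_ofReal (hfp.const_mul _)
              (.of_forall fun x => by positivity), integral_const_mul, ← hAdef]
            congr 1
            field_simp
    have h := (h1 _ hi2 x).trans (mul_le_mul_right hle _)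
    rw [← ENNReal.ofReal_mul hM.le, ← ofReal_norm] at h
    have h' := (ENNReal.ofReal_le_ofReal_iff (by positivity)).1 h
    refine h'.trans (le_of_eq ?_)
    field_simp
  have hsub : {x | t < ‖T f x‖} ⊆ {x | ENNReal.ofReal (t / 2) ≤ ‖T (S.indicator f) x‖ₑ} := by
    intro x hx
    have hx' : t < ‖T f x‖ := hx
    rw [hsplit, hadd _ _ hi1 hi2] at hx'
    have := norm_add_le (T (S.indicator f) x) (T (Sᶜ.indicator f) x)
    have hb := hbig x
    rw [Set.mem_ofPred_eq, ← ofReal_norm]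
    exact ENNReal.ofReal_le_ofReal (by linarith)
  refine (measure_mono hsub).trans ?_
  refine (meas_ge_le_mul_pow_eLpNorm_enorm ν (p := 2) (by norm_num) (by norm_num) (hmeas _ hi1)
    (by simpa using ht) (by simp)).trans ?_
  have hpow2 : eLpNorm (S.indicator f) 2 μ ^ (2 : ℝ≥0∞).toReal =
      ∫⁻ x, S.indicator (fun x => ENNReal.ofReal (‖f x‖ ^ 2)) x ∂μ := by
    have := eLpNorm_nnreal_pow_eq_lintegral (f := S.indicator f) (μ := μ) (p := 2) (by norm_num)
    rw [show (2 : ℝ≥0∞).toReal = ((2 : ℝ≥0) : ℝ) by simp]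
    refine this.trans (lintegral_congr fun x => ?_)
    by_cases hx : x ∈ S
    · rw [Set.indicator_of_mem hx, Set.indicator_of_mem hx, ENNReal.ofReal_pow (norm_nonneg _),
        ofReal_norm]
      simp
    · simp [hx]
  have hc : (ENNReal.ofReal (t / 2))⁻¹ ^ (2 : ℝ≥0∞).toReal = ENNReal.ofReal (4 / t ^ 2) := by
    rw [← ENNReal.ofReal_inv_of_pos (by positivity)]
    simp only [ENNReal.toReal_ofNat, ENNReal.rpow_ofNat]
    rw [← ENNReal.ofReal_pow (by positivity)]
    congr 1
    field_simp
    norm_num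
  rw [hc, ← hpow2]
  gcongr
  exact h2 _ hi1

/-- Layer cake, the distributional bound, and Tonelli. Putting `A` in the truncation threshold
yields the power `A^{q-1}`, whose `q`-th root is `A^{1/p} = ‖f‖_p`. -/
theorem lintegral_norm_rpow_le_of_weak_bounds [SFinite μ]
    {T : (α → ℂ) → β → ℂ} {M : ℝ} (hM : 0 < M)
    (hmeas : ∀ f, Integrable f μ → AEStronglyMeasurable (T f) ν)
    (hadd : ∀ f g, Integrable f μ → Integrable g μ → ∀ x, T (f + g) x = T f x + T g x)
    (h1 : ∀ f, Integrable f μ → ∀ x, ‖T f x‖ₑ ≤ ENNReal.ofReal M * eLpNorm f 1 μ)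
    (h2 : ∀ f, Integrable f μ → eLpNorm (T f) 2 ν ≤ eLpNorm f 2 μ)
    {p q : ℝ} (hpq : p.HolderConjugate q) (hp2 : p < 2) {f : α → ℂ} (hf : Integrable f μ)
    (hfm : StronglyMeasurable f) (hfp : Integrable (fun x => ‖f x‖ ^ p) μ)
    (hA : 0 < ∫ x, ‖f x‖ ^ p ∂μ) :
    ∫⁻ x, ENNReal.ofReal (‖T f x‖ ^ q) ∂ν ≤ ENNReal.ofReal
      (q * (4 / (q - 2) * (2 * M * ∫ x, ‖f x‖ ^ p ∂μ) ^ (q - 2) * ∫ x, ‖f x‖ ^ p ∂μ)) := by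
  set A := ∫ x, ‖f x‖ ^ p ∂μ with hAdef
  have hq2 : 0 < q - 2 := by
    have h := hpq.sub_one_mul_conj
    have := hpq.sub_one_pos
    nlinarith
  set K := 2 * M * A with hK
  have hK0 : 0 < K := by positivity
  rw [lintegral_rpow_eq_lintegral_meas_lt_mul ν (.of_forall fun x => norm_nonneg _)
    (hmeas f hf).norm.aemeasurable hpq.symm.pos, ENNReal.ofReal_mul hpq.symm.nonneg]
  gcongr
  set F : ℝ → α → ℝ≥0∞ := fun t x => {s : ℝ | s * ‖f x‖ ^ (p - 1) ≤ K}.indicator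
      (fun s => ENNReal.ofReal (‖f x‖ ^ 2) * ENNReal.ofReal (4 * s ^ (q - 3))) t with hF
  have hFm : Measurable (Function.uncurry F) := by
    have : Function.uncurry F = {z : ℝ × α | z.1 * ‖f z.2‖ ^ (p - 1) ≤ K}.indicator
        (fun z => ENNReal.ofReal (‖f z.2‖ ^ 2) * ENNReal.ofReal (4 * z.1 ^ (q - 3))) := by
      ext ⟨t, x⟩
      simp only [Function.uncurry, hF, Set.indicator_apply, Set.mem_ofPred_eq]
    rw [this]
    have hn : Measurable fun z : ℝ × α => ‖f z.2‖ := hfm.norm.measurable.comp measurable_snd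
    refine Measurable.indicator ?_ (measurableSet_le (measurable_fst.mul (hn.pow_const _))
      measurable_const)
    exact (hn.pow_const _).ennreal_ofReal.mul
      ((measurable_fst.pow_const _).const_mul _).ennreal_ofReal
  calc ∫⁻ t in Set.Ioi (0 : ℝ), ν {x | t < ‖T f x‖} * ENNReal.ofReal (t ^ (q - 1))
      ≤ ∫⁻ t in Set.Ioi (0 : ℝ), ∫⁻ x, F t x ∂μ := by
        refine setLIntegral_mono' measurableSet_Ioi fun t ht => ?_
        have ht0 : 0 < t := ht
        refine (mul_le_mul_left (meas_norm_gt_le_of_weak_bounds hM hmeas hadd h1 h2 hpq.lt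
          hf hfm hfp hA ht0) _).trans (le_of_eq ?_)
        rw [mul_comm, ← mul_assoc, ← ENNReal.ofReal_mul (by positivity),
          ← lintegral_const_mul' _ _ ENNReal.ofReal_ne_top]
        refine lintegral_congr fun x => ?_
        simp only [hF, Set.indicator_apply, Set.mem_ofPred_eq, ← hAdef, ← hK]
        split_ifs
        · rw [mul_comm]
          congr 2
          rw [show q - 1 = (q - 3) + 2 by ring, Real.rpow_add ht0, Real.rpow_two]
          field_simp
        · simp
    _ = ∫⁻ x, (∫⁻ t in Set.Ioi (0 : ℝ), F t x) ∂μ := lintegral_lintegral_swap hFm.aemeasurable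
    _ ≤ ∫⁻ x, ENNReal.ofReal (4 / (q - 2) * K ^ (q - 2) * ‖f x‖ ^ p) ∂μ :=
        lintegral_mono fun x => lintegral_truncated_rpow_le hpq hp2 hK0 (norm_nonneg _)
    _ = ENNReal.ofReal (4 / (q - 2) * K ^ (q - 2) * A) := by
        rw [← ofReal_integral_eq_lintegral_ofReal (hfp.const_mul _)
          (.of_forall fun x => by positivity), integral_const_mul]

/-- Interpolation between an `L¹ → L^∞` bound `M` and an `L² → L²` bound `1`. -/
theorem eLpNorm_le_of_interpolation [SFinite μ]
    {T : (α → ℂ) → β → ℂ} {M : ℝ} (hM : 0 < M)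
    (hmeas : ∀ f, Integrable f μ → AEStronglyMeasurable (T f) ν)
    (hadd : ∀ f g, Integrable f μ → Integrable g μ → ∀ x, T (f + g) x = T f x + T g x)
    (h1 : ∀ f, Integrable f μ → ∀ x, ‖T f x‖ₑ ≤ ENNReal.ofReal M * eLpNorm f 1 μ)
    (h2 : ∀ f, Integrable f μ → eLpNorm (T f) 2 ν ≤ eLpNorm f 2 μ)
    {p q : ℝ} (hpq : p.HolderConjugate q) (hp2 : p < 2) {f : α → ℂ} (hf : Integrable f μ)
    (hfm : StronglyMeasurable f) (hfp : MemLp f (ENNReal.ofReal p) μ) :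
    eLpNorm (T f) (ENNReal.ofReal q) ν ≤
      ENNReal.ofReal ((q * (4 / (q - 2)) * 2 ^ (q - 2)) ^ (1 / q) * M ^ (2 / p - 1)) *
        eLpNorm f (ENNReal.ofReal p) μ := by
  have hp0 := hpq.pos
  have hq0 := hpq.symm.pos
  have hq2 : 0 < q - 2 := by
    have h := hpq.sub_one_mul_conj
    have := hpq.sub_one_pos
    nlinarith
  have hfpi : Integrable (fun x => ‖f x‖ ^ p) μ := by
    have := hfp.integrable_norm_rpow (by simpa using hp0) ENNReal.ofReal_ne_top
    rwa [ENNReal.toReal_ofReal hp0.le] at this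
  have hA0 : 0 ≤ ∫ x, ‖f x‖ ^ p ∂μ := integral_nonneg fun x => by positivity
  rcases hA0.eq_or_lt with hA | hA
  · have hz : f =ᵐ[μ] 0 := by
      have := (integral_eq_zero_iff_of_nonneg (fun x => by positivity) hfpi).1 hA.symm
      filter_upwards [this] with x hx
      have hx' : ‖f x‖ ^ p = 0 := hx
      simpa using (Real.rpow_eq_zero (norm_nonneg _) hp0.ne').1 hx'
    have hT : ∀ x, T f x = 0 := by
      intro x
      have := h1 f hf x
      rw [eLpNorm_congr_ae hz, eLpNorm_zero, mul_zero] at this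
      simpa using this
    have : T f = 0 := funext hT
    rw [this, eLpNorm_zero]
    exact zero_le
  have key := lintegral_norm_rpow_le_of_weak_bounds hM hmeas hadd h1 h2 hpq hp2 hf hfm hfpi hA
  set A := ∫ x, ‖f x‖ ^ p ∂μ with hAdef
  have hL : eLpNorm f (ENNReal.ofReal p) μ = ENNReal.ofReal (A ^ (1 / p)) := by
    rw [eLpNorm_eq_lintegral_rpow_enorm_toReal (by simpa using hp0) ENNReal.ofReal_ne_top,
      ENNReal.toReal_ofReal hp0.le, hAdef, ← ENNReal.ofReal_rpow_of_nonneg hA0 (by positivity),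
      ofReal_integral_eq_lintegral_ofReal hfpi (.of_forall fun x => by positivity)]
    congr 1
    refine lintegral_congr fun x => ?_
    rw [← ofReal_norm, ENNReal.ofReal_rpow_of_nonneg (norm_nonneg _) hp0.le]
  have hR : eLpNorm (T f) (ENNReal.ofReal q) ν =
      (∫⁻ x, ENNReal.ofReal (‖T f x‖ ^ q) ∂ν) ^ (1 / q) := by
    rw [eLpNorm_eq_lintegral_rpow_enorm_toReal (by simpa using hq0) ENNReal.ofReal_ne_top,
      ENNReal.toReal_ofReal hq0.le]
    congr 1
    refine lintegral_congr fun x => ?_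
    rw [← ofReal_norm, ENNReal.ofReal_rpow_of_nonneg (norm_nonneg _) hq0.le]
  rw [hR, hL, ← ENNReal.ofReal_mul (by positivity)]
  refine (ENNReal.rpow_le_rpow key (by positivity)).trans ?_
  rw [ENNReal.ofReal_rpow_of_nonneg (by positivity) (by positivity)]
  apply ENNReal.ofReal_le_ofReal
  apply le_of_eq
  have e : q * (4 / (q - 2) * (2 * M * A) ^ (q - 2) * A) =
      (q * (4 / (q - 2)) * 2 ^ (q - 2)) * M ^ (q - 2) * A ^ (q - 1) := by
    rw [Real.mul_rpow (by positivity) hA0, Real.mul_rpow (by norm_num) hM.le,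
      show q - 1 = q - 2 + 1 by ring, Real.rpow_add_one hA.ne']
    ring
  rw [e, Real.mul_rpow (by positivity) (by positivity), Real.mul_rpow (by positivity)
    (by positivity), ← Real.rpow_mul hM.le, ← Real.rpow_mul hA0]
  have e1 : 1 / p = 1 - 1 / q := by
    have := hpq.inv_add_inv_eq_one
    rw [one_div, one_div]; linarith
  have e2 : (q - 2) * (1 / q) = 2 / p - 1 := by
    rw [show 2 / p = 2 * (1 / p) by ring, e1]
    field_simp
    ring
  have e3 : (q - 1) * (1 / q) = 1 / p := by
    rw [e1]
    field_simp
  rw [e2, e3]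

end Interpolation

section GaussianMultiplier

variable {V : Type*} [NormedAddCommGroup V] [InnerProductSpace ℝ V] [FiniteDimensional ℝ V]
  [MeasurableSpace V] [BorelSpace V]

/-- The `L^p → L^{p'}` dispersive estimate for Gaussian multipliers. -/
theorem eLpNorm_gaussOp_le {p q : ℝ} (hpq : p.HolderConjugate q) (hp2 : p < 2) {z : ℂ}
    (hz : 0 < z.re) {f : V → ℂ} (hf : Integrable f) (hfp : MemLp f (ENNReal.ofReal p)) :
    eLpNorm (gaussOp z f) (ENNReal.ofReal q) ≤
      ENNReal.ofReal ((q * (4 / (q - 2)) * 2 ^ (q - 2)) ^ (1 / q) *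
        ((Real.pi / ‖z‖) ^ (Module.finrank ℝ V / 2 : ℝ)) ^ (2 / p - 1)) *
        eLpNorm f (ENNReal.ofReal p) := by
  have hz0 : 0 < ‖z‖ := norm_pos_iff.2 (by rintro rfl; simp at hz)
  have hae := hf.1.ae_eq_mk
  rw [gaussOp_congr_ae hz hf hae, eLpNorm_congr_ae hae]
  exact eLpNorm_le_of_interpolation (by positivity)
    (fun g hg => (continuous_gaussOp hz hg).aestronglyMeasurable)
    (fun g h hg hh => gaussOp_add hz hg hh) (fun g hg => enorm_gaussOp_le hz hg)
    (fun g hg => eLpNorm_two_gaussOp_le hz hg) hpq hp2 (hf.congr hae)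
    hf.1.stronglyMeasurable_mk (hfp.ae_eq hae)

end GaussianMultiplier

open Filter Asymptotics

/-! ### Poisson summation in the variable `‖ξ‖²`. -/

section Radial

variable {V : Type*} [NormedAddCommGroup V] [InnerProductSpace ℝ V] [FiniteDimensional ℝ V]
  [MeasurableSpace V] [BorelSpace V]

/-- The density with respect to Lebesgue measure of the push-forward of `h(ξ) dξ` under
`ξ ↦ ‖ξ‖²`. -/
noncomputable def sqNormDensity (h : V → ℂ) (s : ℝ) : ℂ :=
  ((1 / 2 * (max s 0) ^ (Module.finrank ℝ V / 2 - 1 : ℝ) : ℝ) : ℂ) *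
    ∫ ω : Metric.sphere (0 : V) 1, h (√s • (ω : V)) ∂(volume : Measure V).toSphere

/-- Dimension at least 3 makes the exponent `d/2 - 1` positive, so the density vanishes at 0 as well
and extends continuously to the whole line. -/
theorem sqNormDensity_of_nonpos (hd : 3 ≤ Module.finrank ℝ V) (h : V → ℂ) {s : ℝ} (hs : s ≤ 0) :
    sqNormDensity h s = 0 := by
  have hd' : (3 : ℝ) ≤ Module.finrank ℝ V := by exact_mod_cast hd
  rw [sqNormDensity, max_eq_right hs, Real.zero_rpow (by linarith)]
  simp

theorem sqNormDensity_mul_comp (hd : 3 ≤ Module.finrank ℝ V) (h : V → ℂ) (φ : ℝ → ℂ) (s : ℝ) :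
    sqNormDensity (fun ξ => h ξ * φ (‖ξ‖ ^ 2)) s = sqNormDensity h s * φ s := by
  rcases le_or_gt s 0 with hs | hs
  · rw [sqNormDensity_of_nonpos hd _ hs, sqNormDensity_of_nonpos hd _ hs, zero_mul]
  · rw [sqNormDensity, sqNormDensity, mul_assoc, ← integral_mul_const]
    congr 1
    refine integral_congr_ae (.of_forall fun ω => ?_)
    simp only
    rw [norm_smul, norm_eq_of_mem_sphere ω, mul_one, Real.norm_of_nonneg (Real.sqrt_nonneg _),
      Real.sq_sqrt hs.le]

theorem integral_eq_integral_sqNormDensity (hd : 3 ≤ Module.finrank ℝ V) {h : V → ℂ}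
    (hi : Integrable h) : ∫ ξ, h ξ = ∫ s, sqNormDensity h s := by
  have : Nontrivial V := Module.nontrivial_of_finrank_pos (R := ℝ) (by omega)
  set n := Module.finrank ℝ V with hn
  let g : Metric.sphere (0 : V) 1 × Set.Ioi (0 : ℝ) → ℂ := fun p => h ((p.2 : ℝ) • (p.1 : V))
  have hge : ∀ x : ({0}ᶜ : Set V), g (homeomorphUnitSphereProd V x) = h x := by
    intro x
    have hx : ‖(x : V)‖ ≠ 0 := norm_ne_zero_iff.2 x.2
    simp only [g, homeomorphUnitSphereProd_apply_snd_coe, homeomorphUnitSphereProd_apply_fst_coe]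
    rw [smul_smul, mul_inv_cancel₀ hx, one_smul]
  have hmp := (volume : Measure V).measurePreserving_homeomorphUnitSphereProd
  have hemb := (homeomorphUnitSphereProd V).measurableEmbedding
  have hgi : Integrable g
      ((volume : Measure V).toSphere.prod (Measure.volumeIoiPow (n - 1))) := by
    rw [← hmp.integrable_comp_emb hemb]
    have : g ∘ homeomorphUnitSphereProd V =
        fun x : ({0}ᶜ : Set V) => h x := funext hge
    rw [this]
    exact (integrableOn_iff_comap_subtypeVal (measurableSet_singleton (0 : V)).compl).1
      hi.integrableOn
  have h1 : ∫ ξ, h ξ = ∫ r : Set.Ioi (0 : ℝ), (∫ ω, g (ω, r) ∂(volume : Measure V).toSphere)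
      ∂(Measure.volumeIoiPow (n - 1)) := by
    rw [← integral_prod_symm g hgi, ← hmp.integral_comp hemb]
    simp only [hge]
    rw [integral_subtype_comap (measurableSet_singleton _).compl h, restrict_compl_singleton]
  let G : ℝ → ℂ := fun r => ∫ ω : Metric.sphere (0 : V) 1, h (r • (ω : V))
    ∂(volume : Measure V).toSphere
  have h2 : ∫ ξ, h ξ = ∫ r in Set.Ioi (0 : ℝ), (r ^ (n - 1) : ℝ) • G r := by
    rw [h1]
    simp only [Measure.volumeIoiPow, ENNReal.ofReal]
    rw [integral_withDensity_eq_integral_smul,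
      integral_subtype_comap measurableSet_Ioi fun a ↦ Real.toNNReal (a ^ (n - 1)) • G a]
    · refine setIntegral_congr_fun measurableSet_Ioi fun x hx ↦ ?_
      rw [NNReal.smul_def, Real.coe_toNNReal _ (pow_nonneg hx.out.le _)]
    · exact (measurable_subtype_coe.pow_const _).real_toNNReal
  -- Polar coordinates are in place; the substitution `r = √s` passes to the squared norm.
  rw [h2, ← integral_comp_rpow_Ioi_of_pos (p := 1 / 2) (by norm_num)]
  have h3 : ∫ s, sqNormDensity h s = ∫ s in Set.Ioi (0 : ℝ), sqNormDensity h s := by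
    rw [setIntegral_eq_integral_of_forall_compl_eq_zero]
    intro s hs
    exact sqNormDensity_of_nonpos hd h (not_lt.1 hs)
  rw [h3]
  refine setIntegral_congr_fun measurableSet_Ioi fun s hs => ?_
  have hs0 : (0 : ℝ) < s := hs
  simp only [sqNormDensity, G]
  rw [← Real.sqrt_eq_rpow, smul_smul, Complex.real_smul]
  congr 2
  rw [max_eq_left hs0.le, Real.sqrt_eq_rpow, ← Real.rpow_natCast, ← Real.rpow_mul hs0.le,
    mul_assoc, ← Real.rpow_add hs0]
  congr 2
  rw [Nat.cast_sub (by omega)]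
  push_cast
  ring

theorem continuous_sqNormDensity (hd : 3 ≤ Module.finrank ℝ V) {h : V → ℂ} (hc : Continuous h)
    {B : ℝ} (hB : ∀ ξ, ‖h ξ‖ ≤ B) : Continuous (sqNormDensity h) := by
  have hd' : (3 : ℝ) ≤ Module.finrank ℝ V := by exact_mod_cast hd
  refine Continuous.mul ?_ ?_
  · refine Complex.continuous_ofReal.comp (continuous_const.mul ?_)
    exact (continuous_id.max continuous_const).rpow_const fun s => Or.inr (by linarith)
  · refine continuous_of_dominated (bound := fun _ => B) (fun s => ?_) (fun s => ?_)
      (integrable_const _) (.of_forall fun ω => ?_)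
    · exact (hc.comp (continuous_const.smul continuous_subtype_val)).aestronglyMeasurable
    · exact .of_forall fun ω => hB _
    · exact hc.comp (Real.continuous_sqrt.smul continuous_const)

theorem sqNormDensity_isBigO (hd : 3 ≤ Module.finrank ℝ V) {h : V → ℂ}
    {B ε : ℝ} (hε : 0 < ε) (hB : ∀ ξ, ‖h ξ‖ ≤ B * Real.exp (-ε * ‖ξ‖ ^ 2)) :
    sqNormDensity h =O[cocompact ℝ] fun s => |s| ^ (-2 : ℝ) := by
  set a : ℝ := Module.finrank ℝ V / 2 - 1 with ha
  set σ := (volume : Measure V).toSphere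
  rw [cocompact_eq_atBot_atTop]
  refine IsBigO.sup ?_ ?_
  · refine IsBigO.of_bound 1 ?_
    filter_upwards [eventually_le_atBot (0 : ℝ)] with s hs
    rw [sqNormDensity_of_nonpos hd h hs, norm_zero]
    positivity
  · have h1 : sqNormDensity h =O[atTop] fun s => s ^ a * Real.exp (-ε * s) := by
      refine IsBigO.of_bound (1 / 2 * (B * σ.real Set.univ)) ?_
      filter_upwards [eventually_gt_atTop (0 : ℝ)] with s hs
      have hint : ‖∫ ω : Metric.sphere (0 : V) 1, h (√s • (ω : V)) ∂σ‖ ≤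
          B * Real.exp (-ε * s) * σ.real Set.univ := by
        refine norm_integral_le_of_norm_le_const (.of_forall fun ω => ?_)
        have := hB (√s • (ω : V))
        rwa [norm_smul, norm_eq_of_mem_sphere ω, mul_one, Real.norm_of_nonneg (Real.sqrt_nonneg _),
          Real.sq_sqrt hs.le] at this
      rw [sqNormDensity, norm_mul, max_eq_left hs.le, Complex.norm_real, Real.norm_of_nonneg
        (by positivity), Real.norm_of_nonneg (by positivity)]
      calc _ ≤ 1 / 2 * s ^ a * (B * Real.exp (-ε * s) * σ.real Set.univ) := by gcongr
        _ = _ := by ring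
    have h2 : (fun s : ℝ => s ^ a * Real.exp (-ε * s)) =O[atTop] fun s => |s| ^ (-2 : ℝ) := by
      have h3 := (isBigO_refl (fun s : ℝ => s ^ a) atTop).mul
        (isLittleO_exp_neg_mul_rpow_atTop hε (-2 - a)).isBigO
      refine h3.congr' EventuallyEq.rfl ?_
      filter_upwards [eventually_gt_atTop (0 : ℝ)] with s hs
      rw [← Real.rpow_add hs, abs_of_pos hs]
      congr 1; ring
    exact h1.trans h2

/-- Rescaling by 8 turns the progression `3 + 8ℤ` into `3/8 + ℤ`, and the frequency `n` becomes the
phase `exp(-2πi n s/8)`. -/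
theorem fourier_sqNormDensity_comp_mul (hd : 3 ≤ Module.finrank ℝ V) {h : V → ℂ}
    (hi : Integrable h) (n : ℤ) :
    𝓕 (fun u : ℝ => sqNormDensity h (8 * u)) (n : ℝ) =
      1 / 8 * ∫ ξ, h ξ * Complex.exp (-(Real.pi * n / 4 * Complex.I) * ‖ξ‖ ^ 2) := by
  set φ : ℝ → ℂ := fun s => Complex.exp (-(Real.pi * n / 4 * Complex.I) * s) with hφ
  have h1 := integral_eq_integral_sqNormDensity hd (h := fun ξ => h ξ * φ (‖ξ‖ ^ 2)) (by
    refine hi.mul_bdd (c := 1) ?_ (.of_forall fun ξ => ?_)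
    · exact (by fun_prop : Continuous fun ξ : V => φ (‖ξ‖ ^ 2)).aestronglyMeasurable
    · have e : -(Real.pi * n / 4 * Complex.I) * ((‖ξ‖ ^ 2 : ℝ) : ℂ) =
          ((-(Real.pi * n / 4 * ‖ξ‖ ^ 2) : ℝ) : ℂ) * Complex.I := by push_cast; ring
      simp only [hφ]
      rw [e, Complex.norm_exp_ofReal_mul_I])
  simp only [sqNormDensity_mul_comp hd] at h1
  have h2 : ∀ ξ : V, φ (‖ξ‖ ^ 2) =
      Complex.exp (-(Real.pi * n / 4 * Complex.I) * ‖ξ‖ ^ 2) := by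
    intro ξ; simp [hφ]
  simp only [h2] at h1
  rw [h1, Real.fourier_eq']
  have h3 := Measure.integral_comp_mul_left (fun s => sqNormDensity h s * φ s) (8 : ℝ)
  rw [abs_of_pos (by norm_num), Complex.real_smul] at h3
  push_cast at h3
  rw [one_div, ← h3]
  refine integral_congr_ae (.of_forall fun u => ?_)
  simp only [smul_eq_mul, hφ]
  rw [mul_comm]
  congr 2
  simp only [RCLike.inner_apply, conj_trivial]
  push_cast
  ring

/-- Poisson summation over the spheres `‖ξ‖² ≡ 3 mod 8`. -/
theorem hasSum_integral_of_eq_zero_on_spheres (hd : 3 ≤ Module.finrank ℝ V) {h : V → ℂ}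
    (hc : Continuous h) (hi : Integrable h) {B ε : ℝ} (hε : 0 < ε)
    (hB : ∀ ξ, ‖h ξ‖ ≤ B * Real.exp (-ε * ‖ξ‖ ^ 2))
    (hz : ∀ n : ℕ, n % 8 = 3 → ∀ ξ, ‖ξ‖ ^ 2 = n → h ξ = 0)
    (hs : Summable fun n : ℤ =>
      ∫ ξ, h ξ * Complex.exp (-(Real.pi * n / 4 * Complex.I) * ‖ξ‖ ^ 2)) :
    HasSum (fun n : ℤ => fourier n ((3 / 8 : ℝ) : UnitAddCircle) *
      ∫ ξ, h ξ * Complex.exp (-(Real.pi * n / 4 * Complex.I) * ‖ξ‖ ^ 2)) 0 := by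
  have hB0 : 0 ≤ B := by
    have := (norm_nonneg _).trans (hB 0)
    simpa using this
  have hcont : Continuous fun u : ℝ => sqNormDensity h (8 * u) :=
    (continuous_sqNormDensity hd hc (B := B) fun ξ => (hB ξ).trans
      (mul_le_of_le_one_right hB0 (Real.exp_le_one_iff.2 (by nlinarith [sq_nonneg ‖ξ‖])))).comp
        (continuous_const.mul continuous_id)
  have hO : (fun u : ℝ => sqNormDensity h (8 * u)) =O[cocompact ℝ] fun u => |u| ^ (-2 : ℝ) := by
    have h1 := (sqNormDensity_isBigO hd hε hB).comp_tendsto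
      (Homeomorph.mulLeft₀ (8 : ℝ) (by norm_num)).isClosedEmbedding.tendsto_cocompact
    refine h1.trans (IsBigO.of_bound ((8 : ℝ) ^ (-2 : ℝ)) (.of_forall fun u => ?_))
    simp only [Function.comp_apply, Homeomorph.coe_mulLeft₀]
    rw [abs_mul, Real.mul_rpow (abs_nonneg _) (abs_nonneg _), norm_mul,
      Real.norm_of_nonneg (by positivity)]
    norm_num
  have hsum : Summable fun n : ℤ => 𝓕 (fun u : ℝ => sqNormDensity h (8 * u)) (n : ℝ) := by
    simp only [fourier_sqNormDensity_comp_mul hd hi]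
    exact hs.mul_left _
  have hP := Real.tsum_eq_tsum_fourier_of_rpow_decay_of_summable hcont (by norm_num : (1 : ℝ) < 2)
    hO hsum (3 / 8)
  -- For `n < 0` the point lies outside the support of the density; for `n ≥ 0` it is the sphere
  -- `‖ξ‖² = 8n + 3`, where `h` vanishes.
  have hz' : ∀ n : ℤ, sqNormDensity h (8 * (3 / 8 + n)) = 0 := by
    intro n
    rcases lt_or_ge n 0 with hn | hn
    · refine sqNormDensity_of_nonpos hd h ?_
      have : (n : ℝ) ≤ -1 := by exact_mod_cast (by omega : n ≤ -1)
      linarith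
    · obtain ⟨k, rfl⟩ := Int.eq_ofNat_of_zero_le hn
      rw [sqNormDensity]
      have : ∀ ω : Metric.sphere (0 : V) 1, h (√(8 * (3 / 8 + ((k : ℤ) : ℝ))) • (ω : V)) = 0 := by
        intro ω
        refine hz (8 * k + 3) (by omega) _ ?_
        rw [norm_smul, norm_eq_of_mem_sphere ω, mul_one, Real.norm_of_nonneg (Real.sqrt_nonneg _),
          Real.sq_sqrt (by positivity)]
        push_cast
        ring
      simp only [this, integral_zero, mul_zero]
  simp only [hz', tsum_zero, fourier_sqNormDensity_comp_mul hd hi] at hP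
  have hs2 : Summable fun n : ℤ => fourier n ((3 / 8 : ℝ) : UnitAddCircle) *
      ∫ ξ, h ξ * Complex.exp (-(Real.pi * n / 4 * Complex.I) * ‖ξ‖ ^ 2) := by
    refine Summable.of_norm_bounded hs.norm fun n => ?_
    rw [norm_mul, fourier_apply, Circle.norm_coe, one_mul]
  have : ∑' n : ℤ, fourier n ((3 / 8 : ℝ) : UnitAddCircle) *
      ∫ ξ, h ξ * Complex.exp (-(Real.pi * n / 4 * Complex.I) * ‖ξ‖ ^ 2) = 0 := by
    have h8 : ∑' n : ℤ, (1 / 8 : ℂ) * (fourier n ((3 / 8 : ℝ) : UnitAddCircle) *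
      ∫ ξ, h ξ * Complex.exp (-(Real.pi * n / 4 * Complex.I) * ‖ξ‖ ^ 2)) = 0 := by
      rw [hP]
      exact tsum_congr fun n => by ring
    rw [tsum_mul_left] at h8
    simpa using h8
  rw [← this]
  exact hs2.hasSum

theorem norm_add_mul_I_ge {ε : ℝ} (n : ℤ) :
    Real.pi / 4 * |(n : ℝ)| ≤ ‖(ε + Real.pi * n / 4 * Complex.I : ℂ)‖ := by
  have := Complex.abs_im_le_norm (ε + Real.pi * n / 4 * Complex.I : ℂ)
  have e : (ε + Real.pi * n / 4 * Complex.I : ℂ).im = Real.pi / 4 * n := by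
    rw [show (Real.pi * n / 4 : ℂ) = ((Real.pi / 4 * n : ℝ) : ℂ) by push_cast; ring]
    simp
  rwa [e, abs_mul, abs_of_pos (by positivity)] at this

theorem pi_div_norm_le {ε : ℝ} {n : ℤ} (hn : n ≠ 0) :
    Real.pi / ‖(ε + Real.pi * n / 4 * Complex.I : ℂ)‖ ≤ 4 * |(n : ℝ)|⁻¹ := by
  have hn0 : (0 : ℝ) < |(n : ℝ)| := abs_pos.2 (by exact_mod_cast hn)
  calc _ ≤ Real.pi / (Real.pi / 4 * |(n : ℝ)|) := by
        gcongr
        exact norm_add_mul_I_ge n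
    _ = _ := by field_simp

/-- If `𝓕 f` vanishes on the spheres `‖ξ‖² ≡ 3 mod 8`, the Gaussian regularizations of `f` at the
complex times `ε + πin/4` satisfy a linear relation. -/
theorem hasSum_gaussOp (hd : 3 ≤ Module.finrank ℝ V) {f : V → ℂ} (hf : Integrable f)
    (hz : ∀ n : ℕ, n % 8 = 3 → ∀ ξ, ‖ξ‖ ^ 2 = n → 𝓕 f ξ = 0) {ε : ℝ} (hε : 0 < ε) (x : V) :
    HasSum (fun n : ℤ => fourier n ((3 / 8 : ℝ) : UnitAddCircle) *
      gaussOp (ε + Real.pi * n / 4 * Complex.I) f x) 0 := by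
  have hd' : (3 : ℝ) ≤ Module.finrank ℝ V := by exact_mod_cast hd
  set h : V → ℂ := fun ξ =>
    Complex.exp (-ε * ‖ξ‖ ^ 2 + 2 * Real.pi * Complex.I * ⟪x, ξ⟫) * 𝓕 f ξ with hh
  have hre : ∀ n : ℤ, 0 < (ε + Real.pi * n / 4 * Complex.I : ℂ).re := by
    intro n
    rw [show (Real.pi * n / 4 : ℂ) = ((Real.pi / 4 * n : ℝ) : ℂ) by push_cast; ring]
    simpa using hε
  have hg : ∀ n : ℤ, ∫ ξ, h ξ * Complex.exp (-(Real.pi * n / 4 * Complex.I) * ‖ξ‖ ^ 2) =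
      gaussOp (ε + Real.pi * n / 4 * Complex.I) f x := by
    intro n
    rw [gaussOp_eq_integral]
    refine integral_congr_ae (.of_forall fun ξ => ?_)
    simp only [hh]
    rw [mul_right_comm, ← Complex.exp_add]
    congr 2
    ring
  have hcF := continuous_fourier hf
  have hcont : Continuous h := by
    refine Continuous.mul ?_ hcF
    fun_prop
  have hint : Integrable h := by
    have hg1 : Integrable fun ξ : V =>
        Complex.exp (-ε * ‖ξ‖ ^ 2 + 2 * Real.pi * Complex.I * ⟪x, ξ⟫) :=
      GaussianFourier.integrable_cexp_neg_mul_sq_norm_add (b := (ε : ℂ)) (by simpa using hε) _ x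
    exact hg1.mul_bdd (c := ∫ x, ‖f x‖) hcF.aestronglyMeasurable (.of_forall (norm_fourier_le f))
  have hB : ∀ ξ, ‖h ξ‖ ≤ (∫ x, ‖f x‖) * Real.exp (-ε * ‖ξ‖ ^ 2) := by
    intro ξ
    rw [hh, norm_mul, mul_comm]
    refine mul_le_mul (norm_fourier_le f ξ) (le_of_eq ?_) (norm_nonneg _)
      (integral_nonneg fun y => norm_nonneg (f y))
    rw [Complex.norm_exp]
    congr 1
    have e : (-ε * ‖ξ‖ ^ 2 + 2 * Real.pi * Complex.I * ⟪x, ξ⟫ : ℂ) =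
        ((-ε * ‖ξ‖ ^ 2 : ℝ) : ℂ) + ((2 * Real.pi * ⟪x, ξ⟫ : ℝ) : ℂ) * Complex.I := by
      push_cast; ring
    rw [e, Complex.add_re, Complex.ofReal_re, Complex.re_ofReal_mul, Complex.I_re, mul_zero,
      add_zero]
  -- The `L¹ → L^∞` bound gives decay `|n|^{-d/2}`, summable because `d ≥ 3`; this licenses Poisson
  -- summation.
  have hsum : Summable fun n : ℤ => gaussOp (ε + Real.pi * n / 4 * Complex.I) f x := by
    have hr := (Real.summable_abs_int_rpow (b := Module.finrank ℝ V / 2) (by linarith)).mul_left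
      ((4 : ℝ) ^ (Module.finrank ℝ V / 2 : ℝ) * ∫ y, ‖f y‖)
    refine Summable.of_norm_bounded_eventually hr ?_
    filter_upwards [(Set.finite_singleton (0 : ℤ)).compl_mem_cofinite] with n hn
    have hn0 : n ≠ 0 := hn
    have hnn : (0 : ℝ) ≤ |(n : ℝ)| := abs_nonneg _
    refine (norm_gaussOp_le (hre n) hf x).trans ?_
    rw [Real.rpow_neg hnn, mul_right_comm, ← Real.inv_rpow hnn,
      ← Real.mul_rpow (by norm_num) (by positivity)]
    refine mul_le_mul_of_nonneg_right ?_ (integral_nonneg fun y => norm_nonneg (f y))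
    exact Real.rpow_le_rpow (by positivity) (pi_div_norm_le hn0) (by positivity)
  have key := hasSum_integral_of_eq_zero_on_spheres hd hcont hint hε hB
    (fun n hn ξ hξ => by rw [hh]; simp only [hz n hn ξ hξ, mul_zero]) (by simpa only [hg] using hsum)
  simpa only [hg] using key

end Radial

/-- The countable triangle inequality for a pointwise sum: Fatou's lemma along an exhausting
sequence of finite index sets. -/
theorem eLpNorm_le_of_hasSum {α ι : Type*} [MeasurableSpace α] [Countable ι] {μ : Measure α}
    {v : ι → α → ℂ} {u : α → ℂ} (hv : ∀ i, AEStronglyMeasurable (v i) μ)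
    (hu : ∀ x, HasSum (fun i => v i x) (u x)) {q : ℝ≥0∞} (hq : 1 ≤ q) :
    eLpNorm u q μ ≤ ∑' i, eLpNorm (v i) q μ := by
  obtain ⟨s, hs⟩ := Filter.exists_seq_tendsto (atTop : Filter (Finset ι))
  have hle : ∀ n, eLpNorm (fun x => ∑ i ∈ s n, v i x) q μ ≤ ∑' i, eLpNorm (v i) q μ := by
    intro n
    have e : (fun x => ∑ i ∈ s n, v i x) = ∑ i ∈ s n, v i := by ext x; simp
    rw [e]
    exact (eLpNorm_sum_le (fun i _ => hv i) hq).trans (ENNReal.sum_le_tsum _)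
  refine (Lp.eLpNorm_lim_le_liminf_eLpNorm (f := fun n x => ∑ i ∈ s n, v i x) (fun n => ?_) u
    (.of_forall fun x => (hu x).comp hs)).trans ?_
  · exact Finset.aestronglyMeasurable_fun_sum _ fun i _ => hv i
  · refine (liminf_le_liminf (.of_forall hle)).trans ?_
    simp

open Filter Topology

/-! ### Almost everywhere convergence of Gaussian regularizations. -/

section ApproximateIdentity

variable {V : Type*} [NormedAddCommGroup V] [InnerProductSpace ℝ V] [FiniteDimensional ℝ V]
  [MeasurableSpace V] [BorelSpace V]

theorem lintegral_enorm_gaussKernel {ε : ℝ} (hε : 0 < ε) :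
    ∫⁻ x : V, ‖gaussKernel (ε : ℂ) x‖ₑ = 1 := by
  set a : ℝ := Module.finrank ℝ V / 2 with ha
  have hn : ∀ x : V, ‖gaussKernel (ε : ℂ) x‖ =
      (Real.pi / ε) ^ a * Real.exp (-(Real.pi ^ 2 / ε) * ‖x‖ ^ 2) := by
    intro x
    rw [gaussKernel, norm_mul, Complex.norm_exp]
    congr 1
    · have e : (Module.finrank ℝ V / 2 : ℂ) = (a : ℂ) := by rw [ha]; push_cast; rfl
      rw [e, ← Complex.ofReal_div, Complex.norm_cpow_real, Complex.norm_real,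
        Real.norm_of_nonneg (by positivity)]
    · have e : (-Real.pi ^ 2 * ‖x‖ ^ 2 / ε : ℂ) =
          ((-(Real.pi ^ 2 / ε) * ‖x‖ ^ 2 : ℝ) : ℂ) := by push_cast; ring
      rw [e, Complex.ofReal_re]
  have hi : Integrable fun x : V => Real.exp (-(Real.pi ^ 2 / ε) * ‖x‖ ^ 2) := by
    have h := (integrable_cexp_neg_mul_sq (V := V) (z := ((Real.pi ^ 2 / ε : ℝ) : ℂ))
      (by rw [Complex.ofReal_re]; positivity)).norm
    refine h.congr (.of_forall fun x => ?_)
    simp only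
    rw [Complex.norm_exp]
    congr 1
    have e : (-((Real.pi ^ 2 / ε : ℝ) : ℂ) * ‖x‖ ^ 2 : ℂ) =
          ((-(Real.pi ^ 2 / ε) * ‖x‖ ^ 2 : ℝ) : ℂ) := by push_cast; ring
    rw [e, Complex.ofReal_re]
  have h1 : ∫⁻ x : V, ‖gaussKernel (ε : ℂ) x‖ₑ =
      ∫⁻ x : V, ENNReal.ofReal ((Real.pi / ε) ^ a * Real.exp (-(Real.pi ^ 2 / ε) * ‖x‖ ^ 2)) :=
    lintegral_congr fun x => by rw [← ofReal_norm, hn]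
  rw [h1, ← ofReal_integral_eq_lintegral_ofReal (hi.const_mul _)
    (.of_forall fun x => by positivity), integral_const_mul,
    GaussianFourier.integral_rexp_neg_mul_sq_norm (by positivity), ← ha,
    ← Real.mul_rpow (by positivity) (by positivity)]
  have : Real.pi / ε * (Real.pi / (Real.pi ^ 2 / ε)) = 1 := by
    have := Real.pi_pos
    field_simp
  rw [this, Real.one_rpow, ENNReal.ofReal_one]

theorem enorm_gaussOp_le_lintegral {z : ℂ} (hz : 0 < z.re) {f : V → ℂ} (hf : Integrable f)
    (x : V) : ‖gaussOp z f x‖ₑ ≤ ∫⁻ y, ‖f y‖ₑ * ‖gaussKernel z (x - y)‖ₑ := by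
  rw [gaussOp_eq_integral_kernel hz hf]
  refine (enorm_integral_le_lintegral_enorm _).trans (le_of_eq ?_)
  exact lintegral_congr fun y => enorm_mul _ _

theorem eLpNorm_one_gaussOp_le {ε : ℝ} (hε : 0 < ε) {f : V → ℂ} (hf : Integrable f) :
    eLpNorm (gaussOp ε f) 1 ≤ eLpNorm f 1 := by
  have hz : 0 < (ε : ℂ).re := by simpa using hε
  rw [eLpNorm_one_eq_lintegral_enorm, eLpNorm_one_eq_lintegral_enorm]
  have hK : Measurable fun w : V × V => ‖gaussKernel (ε : ℂ) (w.1 - w.2)‖ₑ :=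
    ((continuous_gaussKernel (ε : ℂ)).comp (continuous_fst.sub continuous_snd)).measurable.enorm
  calc ∫⁻ x, ‖gaussOp ε f x‖ₑ
      ≤ ∫⁻ x, ∫⁻ y, ‖f y‖ₑ * ‖gaussKernel (ε : ℂ) (x - y)‖ₑ :=
        lintegral_mono fun x => enorm_gaussOp_le_lintegral hz hf x
    _ = ∫⁻ y, ∫⁻ x, ‖f y‖ₑ * ‖gaussKernel (ε : ℂ) (x - y)‖ₑ := by
        refine lintegral_lintegral_swap ?_
        exact (hf.1.comp_snd.enorm).mul hK.aemeasurable
    _ = ∫⁻ y, ‖f y‖ₑ := by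
        refine lintegral_congr fun y => ?_
        rw [lintegral_const_mul' _ _ enorm_ne_top,
          lintegral_sub_right_eq_self (fun x => ‖gaussKernel (ε : ℂ) x‖ₑ) y,
          lintegral_enorm_gaussKernel hε, mul_one]

theorem enorm_gaussOp_le_of_bound {ε : ℝ} (hε : 0 < ε) {f : V → ℂ} (hf : Integrable f)
    {B : ℝ≥0∞} (hB : ∀ x, ‖f x‖ₑ ≤ B) (x : V) : ‖gaussOp ε f x‖ₑ ≤ B := by
  have hz : 0 < (ε : ℂ).re := by simpa using hε
  calc ‖gaussOp ε f x‖ₑ ≤ ∫⁻ y, ‖f y‖ₑ * ‖gaussKernel (ε : ℂ) (x - y)‖ₑ :=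
        enorm_gaussOp_le_lintegral hz hf x
    _ ≤ ∫⁻ y, B * ‖gaussKernel (ε : ℂ) (x - y)‖ₑ := by
        gcongr with y
        exact hB y
    _ = B := by
        have hm : Measurable fun y => ‖gaussKernel (ε : ℂ) (x - y)‖ₑ :=
          ((continuous_gaussKernel (ε : ℂ)).comp
            (continuous_const.sub continuous_id)).measurable.enorm
        rw [lintegral_const_mul _ hm,
          lintegral_sub_left_eq_self (fun y => ‖gaussKernel (ε : ℂ) y‖ₑ) x,
          lintegral_enorm_gaussKernel hε, mul_one]

theorem tendsto_gaussOp_of_continuous {f : V → ℂ} (hf : Integrable f) (hc : Continuous f)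
    (x : V) :
    Tendsto (fun n : ℕ => gaussOp ((1 / ((n : ℝ) + 1) : ℝ) : ℂ) f x) atTop (𝓝 (f x)) := by
  have h := (Real.tendsto_integral_gaussian_smul' hf hc.continuousAt (v := x)).comp
    (tendsto_atTop_add_const_right atTop (1 : ℝ) tendsto_natCast_atTop_atTop)
  refine h.congr fun n => ?_
  have hpos : (0 : ℝ) < 1 / ((n : ℝ) + 1) := by positivity
  rw [gaussOp_eq_integral_kernel (by rw [Complex.ofReal_re]; exact hpos) hf]
  refine integral_congr_ae (.of_forall fun y => ?_)
  simp only [smul_eq_mul, gaussKernel]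
  rw [mul_comm]
  congr 2
  · push_cast; simp
  · push_cast; congr 1; simp only [one_div, div_inv_eq_mul]; ring

/-- Approximation by compactly supported continuous functions, where the convergence is pointwise
and bounded. Finiteness of `μ` makes the constant bound integrable for dominated convergence. -/
theorem tendsto_eLpNorm_gaussOp_sub {μ : Measure V} [IsFiniteMeasure μ] (hμ : μ ≤ volume)
    {f : V → ℂ} (hf : Integrable f) :
    Tendsto (fun n : ℕ => eLpNorm (gaussOp ((1 / ((n : ℝ) + 1) : ℝ) : ℂ) f - f) 1 μ)
      atTop (𝓝 0) := by
  have hpos : ∀ n : ℕ, (0 : ℝ) < 1 / ((n : ℝ) + 1) := fun n => by positivity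
  have hre : ∀ n : ℕ, 0 < (((1 / ((n : ℝ) + 1) : ℝ) : ℂ)).re := fun n => by
    rw [Complex.ofReal_re]; exact hpos n
  rw [ENNReal.tendsto_nhds_zero]
  intro δ hδ
  obtain ⟨g, hgc, hfg, hg, hgi⟩ :=
    (memLp_one_iff_integrable.2 hf).exists_hasCompactSupport_eLpNorm_sub_le
      ENNReal.one_ne_top (ε := δ / 3) (by simpa using hδ.ne')
  rw [memLp_one_iff_integrable] at hgi
  obtain ⟨B, hB⟩ := hg.bounded_above_of_compact_support hgc
  have hBe : ∀ x, ‖g x‖ₑ ≤ ENNReal.ofReal B := fun x => by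
    rw [← ofReal_norm]; exact ENNReal.ofReal_le_ofReal (hB x)
  have hlim : Tendsto (fun n : ℕ => eLpNorm (gaussOp ((1 / ((n : ℝ) + 1) : ℝ) : ℂ) g - g) 1 μ)
      atTop (𝓝 0) := by
    simp only [eLpNorm_one_eq_lintegral_enorm]
    have := tendsto_lintegral_of_dominated_convergence (μ := μ)
      (F := fun (n : ℕ) x => ‖(gaussOp ((1 / ((n : ℝ) + 1) : ℝ) : ℂ) g - g) x‖ₑ) (f := fun _ => 0)
      (fun _ => ENNReal.ofReal B + ENNReal.ofReal B)
      (fun n => ((continuous_gaussOp (hre n) hgi).sub hg).measurable.enorm)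
      (fun n => .of_forall fun x => (enorm_sub_le).trans
        (add_le_add (enorm_gaussOp_le_of_bound (hpos n) hgi hBe x) (hBe x)))
      (by simp [ENNReal.mul_eq_top])
      (.of_forall fun x => by
        have h := ((tendsto_gaussOp_of_continuous hgi hg x).sub_const (g x)).enorm
        simpa using h)
    simpa using this
  rw [ENNReal.tendsto_nhds_zero] at hlim
  filter_upwards [hlim (δ / 3) (by simpa using hδ.ne')] with n hn
  set T := gaussOp (V := V) ((1 / ((n : ℝ) + 1) : ℝ) : ℂ) with hT
  have e : T f - f = (T (f - g) + (T g - g)) - (f - g) := by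
    have h := funext (gaussOp_add (hre n) (hf.sub hgi) hgi)
    rw [sub_add_cancel] at h
    ext x
    have hx := congrFun h x
    simp only [Pi.sub_apply, Pi.add_apply, hT] at hx ⊢
    rw [hx]; ring
  have hTm : ∀ u, Integrable u → AEStronglyMeasurable (T u) μ := fun u hu =>
    (continuous_gaussOp (hre n) hu).aestronglyMeasurable
  have hfgm : AEStronglyMeasurable (f - g) μ := (hf.sub hgi).1.mono_measure hμ
  have h2 : eLpNorm (f - g) 1 μ ≤ δ / 3 := (eLpNorm_mono_measure _ hμ).trans hfg
  have h1 : eLpNorm (T (f - g)) 1 μ ≤ δ / 3 :=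
    (eLpNorm_mono_measure _ hμ).trans ((eLpNorm_one_gaussOp_le (hpos n) (hf.sub hgi)).trans hfg)
  rw [e]
  calc _ ≤ eLpNorm (T (f - g) + (T g - g)) 1 μ + eLpNorm (f - g) 1 μ :=
        eLpNorm_sub_le ((hTm _ (hf.sub hgi)).add ((hTm _ hgi).sub hg.aestronglyMeasurable)) hfgm
          le_rfl
    _ ≤ (δ / 3 + δ / 3) + δ / 3 := by
        refine add_le_add ((eLpNorm_add_le (hTm _ (hf.sub hgi))
          ((hTm _ hgi).sub hg.aestronglyMeasurable) le_rfl).trans (add_le_add h1 hn)) h2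
    _ = δ := ENNReal.add_thirds δ

/-- Gaussian regularizations of an integrable function converge almost everywhere along a
sequence of times. -/
theorem exists_seq_tendsto_gaussOp {f : V → ℂ} (hf : Integrable f) :
    ∃ ε : ℕ → ℝ, (∀ n, 0 < ε n) ∧
      ∀ᵐ x, Tendsto (fun n => gaussOp (ε n : ℂ) f x) atTop (𝓝 (f x)) := by
  have hre : ∀ n : ℕ, 0 < (((1 / ((n : ℝ) + 1) : ℝ) : ℂ)).re := fun n => by
    rw [Complex.ofReal_re]; positivity
  -- A Gaussian weight gives a finite measure below Lebesgue measure with the same null sets, so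
  -- almost everywhere convergence transfers back.
  let w : V → ℝ := fun x => ‖Complex.exp (-1 * ‖x‖ ^ 2)‖
  have hw : Integrable w := (integrable_cexp_neg_mul_sq (V := V) (z := 1) (by simp)).norm
  let μ : Measure V := (volume : Measure V).withDensity fun x => ENNReal.ofReal (w x)
  have : IsFiniteMeasure μ := isFiniteMeasure_withDensity_ofReal hw.2
  have hμ : μ ≤ volume := by
    refine (withDensity_mono (g := 1) (.of_forall fun x => ?_)).trans (le_of_eq withDensity_one)
    simp only [Pi.one_apply, ENNReal.ofReal_le_one, w]
    rw [Complex.norm_exp, Real.exp_le_one_iff,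
      show (-1 * ‖x‖ ^ 2 : ℂ) = ((-(‖x‖ ^ 2) : ℝ) : ℂ) by push_cast; ring, Complex.ofReal_re]
    nlinarith [sq_nonneg ‖x‖]
  have hac : (volume : Measure V) ≪ μ :=
    withDensity_absolutelyContinuous' hw.1.aemeasurable.ennreal_ofReal (.of_forall fun x => by
      simp only [w, ne_eq, ENNReal.ofReal_eq_zero, not_le, norm_pos_iff]
      exact Complex.exp_ne_zero _)
  have hm := tendstoInMeasure_of_tendsto_eLpNorm one_ne_zero
    (fun n => (continuous_gaussOp (hre n) hf).aestronglyMeasurable) (hf.1.mono_measure hμ)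
    (tendsto_eLpNorm_gaussOp_sub hμ hf)
  obtain ⟨ns, -, hns⟩ := hm.exists_seq_tendsto_ae
  exact ⟨fun n => 1 / ((ns n : ℝ) + 1), fun n => by positivity, hac.ae_le hns⟩

end ApproximateIdentity

/-! ### Intermediate exponents and the final estimate. -/

/-- After scaling by `a`, pointwise `y^r ≤ y^p + y^q` when `q` is finite, while `y ≤ 1` almost
everywhere when `q = ∞`. The constant is `2^{1/r} ≤ 2`. -/
theorem eLpNorm_le_two_mul_of_le_of_le {α : Type*} [MeasurableSpace α] {μ : Measure α}
    {f : α → ℂ} (hf : AEStronglyMeasurable f μ) {p q r a : ℝ≥0∞} (hp : 1 ≤ p) (hpr : p ≤ r)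
    (hrq : r ≤ q) (ha0 : a ≠ 0) (hat : a ≠ ∞) (hfp : eLpNorm f p μ ≤ a) (hfq : eLpNorm f q μ ≤ a) :
    eLpNorm f r μ ≤ 2 * a := by
  have h2a : a ≤ 2 * a := by rw [two_mul]; exact le_self_add
  rcases eq_or_ne r ∞ with rfl | hrt
  · rw [top_le_iff] at hrq
    rw [← hrq]
    exact hfq.trans h2a
  have hpt : p ≠ ∞ := ne_top_of_le_ne_top hrt hpr
  have hp0 : p ≠ 0 := (zero_lt_one.trans_le hp).ne'
  have hr0 : r ≠ 0 := (zero_lt_one.trans_le (hp.trans hpr)).ne'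
  have hr1 : 1 ≤ r.toReal := by
    have := ENNReal.toReal_mono hrt (hp.trans hpr)
    simpa using this
  have hprR : p.toReal ≤ r.toReal := ENNReal.toReal_mono hrt hpr
  have hscale : ∀ s : ℝ≥0∞, s ≠ 0 → s ≠ ∞ → eLpNorm f s μ ≤ a →
      ∫⁻ x, (‖f x‖ₑ / a) ^ s.toReal ∂μ ≤ 1 := by
    intro s hs0 hst hs
    have hspos : 0 < s.toReal := ENNReal.toReal_pos hs0 hst
    have e : ∀ x, (‖f x‖ₑ / a) ^ s.toReal = ‖f x‖ₑ ^ s.toReal * (a ^ s.toReal)⁻¹ := fun x => by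
      rw [ENNReal.div_rpow_of_nonneg _ _ hspos.le, div_eq_mul_inv]
    have ha1 : a ^ s.toReal ≠ 0 := by simp [ha0, hat]
    have ha2 : a ^ s.toReal ≠ ∞ := ENNReal.rpow_ne_top_of_nonneg hspos.le hat
    simp only [e]
    rw [lintegral_mul_const' _ _ (ENNReal.inv_ne_top.2 ha1), ← div_eq_mul_inv]
    refine ENNReal.div_le_of_le_mul ?_
    rw [one_mul]
    rw [eLpNorm_eq_lintegral_rpow_enorm_toReal hs0 hst, one_div,
      ENNReal.rpow_inv_le_iff hspos] at hs
    exact hs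
  have hI : ∫⁻ x, (‖f x‖ₑ / a) ^ r.toReal ∂μ ≤ 2 := by
    rcases eq_or_ne q ∞ with rfl | hqt
    · rw [eLpNorm_exponent_top] at hfq
      have hle : ∀ᵐ x ∂μ, ‖f x‖ₑ / a ≤ 1 := by
        filter_upwards [ae_le_eLpNormEssSup (f := f) (μ := μ)] with x hx
        exact ENNReal.div_le_of_le_mul (by rw [one_mul]; exact hx.trans hfq)
      calc _ ≤ ∫⁻ x, (‖f x‖ₑ / a) ^ p.toReal ∂μ := by
            refine lintegral_mono_ae ?_
            filter_upwards [hle] with x hx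
            exact ENNReal.rpow_le_rpow_of_exponent_ge hx hprR
        _ ≤ 1 := hscale p hp0 hpt hfp
        _ ≤ 2 := by norm_num
    · have hq0 : q ≠ 0 := (zero_lt_one.trans_le (hp.trans (hpr.trans hrq))).ne'
      have hrqR : r.toReal ≤ q.toReal := ENNReal.toReal_mono hqt hrq
      calc _ ≤ ∫⁻ x, ((‖f x‖ₑ / a) ^ p.toReal + (‖f x‖ₑ / a) ^ q.toReal) ∂μ := by
            refine lintegral_mono fun x => ?_
            rcases le_total (‖f x‖ₑ / a) 1 with hx | hx
            · exact (ENNReal.rpow_le_rpow_of_exponent_ge hx hprR).trans le_self_add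
            · exact (ENNReal.rpow_le_rpow_of_exponent_le hx hrqR).trans le_add_self
        _ = ∫⁻ x, (‖f x‖ₑ / a) ^ p.toReal ∂μ + ∫⁻ x, (‖f x‖ₑ / a) ^ q.toReal ∂μ :=
            lintegral_add_left' ((hf.enorm.div_const a).pow_const _) _
        _ ≤ 1 + 1 := add_le_add (hscale p hp0 hpt hfp) (hscale q hq0 hqt hfq)
        _ = 2 := by norm_num
  have hrpos : 0 < r.toReal := by linarith
  have hA : ∫⁻ x, ‖f x‖ₑ ^ r.toReal ∂μ ≤ 2 * a ^ r.toReal := by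
    have e : ∀ x, ‖f x‖ₑ ^ r.toReal = (‖f x‖ₑ / a) ^ r.toReal * a ^ r.toReal := fun x => by
      rw [← ENNReal.mul_rpow_of_nonneg _ _ hrpos.le, ENNReal.div_mul_cancel ha0 hat]
    simp only [e]
    rw [lintegral_mul_const' _ _ (ENNReal.rpow_ne_top_of_nonneg hrpos.le hat)]
    gcongr
  rw [eLpNorm_eq_lintegral_rpow_enorm_toReal hr0 hrt, one_div, ENNReal.rpow_inv_le_iff hrpos,
    ENNReal.mul_rpow_of_nonneg _ _ hrpos.le]
  refine hA.trans ?_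
  gcongr
  calc (2 : ℝ≥0∞) = 2 ^ (1 : ℝ) := by simp
    _ ≤ 2 ^ r.toReal := ENNReal.rpow_le_rpow_of_exponent_le (by norm_num) hr1

section Main

variable {V : Type*} [NormedAddCommGroup V] [InnerProductSpace ℝ V] [FiniteDimensional ℝ V]
  [MeasurableSpace V] [BorelSpace V]

/-- If `𝓕 f` vanishes on the spheres `‖ξ‖² ≡ 3 mod 8`, a summable dispersive estimate for the
complex Gaussian multipliers bounds the real ones uniformly. -/
theorem eLpNorm_gaussOp_le_of_dispersive (hd : 3 ≤ Module.finrank ℝ V) {f : V → ℂ}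
    (hf : Integrable f) (hz : ∀ n : ℕ, n % 8 = 3 → ∀ ξ, ‖ξ‖ ^ 2 = n → 𝓕 f ξ = 0)
    {q N : ℝ≥0∞} (hq : 1 ≤ q) {D γ : ℝ} (hD : 0 ≤ D) (hγ : 1 < γ)
    (H : ∀ z : ℂ, 0 < z.re →
      eLpNorm (gaussOp z f) q ≤ ENNReal.ofReal (D * (Real.pi / ‖z‖) ^ γ) * N)
    {ε : ℝ} (hε : 0 < ε) :
    eLpNorm (gaussOp ε f) q ≤
      ENNReal.ofReal (∑' n : ℤ, D * 4 ^ γ * |(n : ℝ)| ^ (-γ)) * N := by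
  set F : ℤ → V → ℂ := fun n x => fourier n ((3 / 8 : ℝ) : UnitAddCircle) *
      gaussOp (ε + Real.pi * n / 4 * Complex.I) f x with hF
  -- The relation is solved for its `n = 0` term, which is `gaussOp ε f` itself since the phase
  -- there is 1. Thus `v 0 = 0` and `v` sums to `gaussOp ε f`.
  set v : ℤ → V → ℂ := fun n x => (if n = 0 then gaussOp ε f x else 0) - F n x with hv
  have hre : ∀ n : ℤ, 0 < (ε + Real.pi * n / 4 * Complex.I : ℂ).re := by
    intro n
    rw [show (Real.pi * n / 4 : ℂ) = ((Real.pi / 4 * n : ℝ) : ℂ) by push_cast; ring]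
    simpa using hε
  have hv0 : v 0 = 0 := by
    ext x
    simp [hv, hF]
  have hvn : ∀ n, n ≠ 0 → v n = fun x => -F n x := by
    intro n hn
    ext x
    simp [hv, hn]
  have hFc : ∀ n, Continuous (F n) := fun n =>
    continuous_const.mul (continuous_gaussOp (hre n) hf)
  have hvm : ∀ n, AEStronglyMeasurable (v n) (volume : Measure V) := by
    intro n
    rcases eq_or_ne n 0 with rfl | hn
    · rw [hv0]; exact aestronglyMeasurable_zero
    · rw [hvn n hn]; exact (hFc n).neg.aestronglyMeasurable
  have hsum : ∀ x, HasSum (fun n => v n x) (gaussOp ε f x) := by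
    intro x
    have := (hasSum_ite_eq (0 : ℤ) (gaussOp ε f x)).sub (hasSum_gaussOp hd hf hz hε x)
    rwa [sub_zero] at this
  have hS : Summable fun n : ℤ => D * 4 ^ γ * |(n : ℝ)| ^ (-γ) :=
    (Real.summable_abs_int_rpow hγ).mul_left _
  refine (eLpNorm_le_of_hasSum hvm hsum hq).trans ?_
  rw [ENNReal.ofReal_tsum_of_nonneg (fun n => by positivity) hS, ← ENNReal.tsum_mul_right]
  refine ENNReal.tsum_le_tsum fun n => ?_
  rcases eq_or_ne n 0 with rfl | hn
  · rw [hv0, eLpNorm_zero]; exact zero_le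
  have hnorm : ∀ x, ‖v n x‖ ≤ ‖gaussOp (ε + Real.pi * n / 4 * Complex.I) f x‖ := by
    intro x
    rw [hvn n hn, norm_neg, hF, norm_mul, fourier_apply, Circle.norm_coe, one_mul]
  refine (eLpNorm_mono hnorm).trans ((H _ (hre n)).trans ?_)
  refine mul_le_mul_left (ENNReal.ofReal_le_ofReal ?_) N
  rw [mul_assoc]
  refine mul_le_mul_of_nonneg_left ?_ hD
  rw [Real.rpow_neg (abs_nonneg _), ← Real.inv_rpow (abs_nonneg _),
    ← Real.mul_rpow (by norm_num) (by positivity)]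
  exact Real.rpow_le_rpow (by positivity) (pi_div_norm_le hn) (by linarith)

theorem eLpNorm_le_of_dispersive (hd : 3 ≤ Module.finrank ℝ V) {f : V → ℂ}
    (hf : Integrable f) (hz : ∀ n : ℕ, n % 8 = 3 → ∀ ξ, ‖ξ‖ ^ 2 = n → 𝓕 f ξ = 0)
    {q N : ℝ≥0∞} (hq : 1 ≤ q) {D γ : ℝ} (hD : 0 ≤ D) (hγ : 1 < γ)
    (H : ∀ z : ℂ, 0 < z.re →
      eLpNorm (gaussOp z f) q ≤ ENNReal.ofReal (D * (Real.pi / ‖z‖) ^ γ) * N) :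
    eLpNorm f q ≤ ENNReal.ofReal (∑' n : ℤ, D * 4 ^ γ * |(n : ℝ)| ^ (-γ)) * N := by
  obtain ⟨ε, hε, hlim⟩ := exists_seq_tendsto_gaussOp hf
  refine (Lp.eLpNorm_lim_le_liminf_eLpNorm (fun n => (continuous_gaussOp
    (by simpa using hε n) hf).aestronglyMeasurable) f hlim).trans ?_
  refine (liminf_le_liminf (.of_forall fun n =>
    eLpNorm_gaussOp_le_of_dispersive hd hf hz hq hD hγ H (hε n))).trans ?_
  simp

end Main

theorem exists_eLpNorm_conjugate_le (d : ℕ) (hd : 3 ≤ d) (p p' : ℝ≥0∞) (hp1 : 1 ≤ p)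
    (hp2 : p < 2 * (d : ℝ≥0∞) / ((d : ℝ≥0∞) + 2)) (hpp' : ENNReal.HolderConjugate p p') :
    ∃ C : ℝ≥0, ∀ f : E d → ℂ, MemLp f 1 volume → MemLp f p volume →
      HasVanishingPeriodizations f →
        eLpNorm f p' volume ≤ (C : ℝ≥0∞) * eLpNorm f p volume := by
  have hdR : (3 : ℝ) ≤ d := by exact_mod_cast hd
  have hfin : Module.finrank ℝ (E d) = d := finrank_euclideanSpace_fin
  have hp'1 : 1 ≤ p' := hpp'.symm.one_le
  -- For `p = 1` the kernel bound is already the dispersive estimate, with `γ = d/2`; the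
  -- interpolation argument needs `p > 1`.
  rcases hp1.eq_or_lt with rfl | hp1
  · have hp' : p' = ∞ := by
      have := ENNReal.holderConjugate_iff.1 hpp'
      rw [inv_one] at this
      have h0 : p'⁻¹ = 0 := by
        have h1 : (1 : ℝ≥0∞) + p'⁻¹ = 1 + 0 := by rw [this, add_zero]
        exact (ENNReal.add_right_inj ENNReal.one_ne_top).1 h1
      exact ENNReal.inv_eq_zero.1 h0
    subst hp'
    refine ⟨(∑' n : ℤ, 1 * 4 ^ ((d : ℝ) / 2) * |(n : ℝ)| ^ (-((d : ℝ) / 2))).toNNReal,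
      fun f hf _ hv => ?_⟩
    rw [memLp_one_iff_integrable] at hf
    refine eLpNorm_le_of_dispersive (by rw [hfin]; exact hd) hf
      (fun n hn ξ hξ => fourier_eq_zero_of_norm_sq_eq hd hf hv hn hξ) hp'1 zero_le_one
      (by linarith) (fun z hz => ?_)
    rw [eLpNorm_exponent_top, one_mul]
    refine eLpNormEssSup_le_of_ae_enorm_bound (.of_forall fun x => ?_)
    have := enorm_gaussOp_le hz hf x
    rwa [hfin] at this
  · have hpt : p ≠ ∞ := ne_top_of_lt hp2
    have hp't : p' ≠ ∞ := ((ENNReal.HolderConjugate.lt_top_iff_one_lt p' p).2 hp1).ne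
    have hPQ : p.toReal.HolderConjugate p'.toReal :=
      ENNReal.HolderConjugate.toReal_of_ne_top hpt hp't
    have hP1 := hPQ.lt
    have hP : p.toReal * (d + 2) < 2 * d := by
      rw [ENNReal.lt_div_iff_mul_lt (by simp) (by simp)] at hp2
      have h := ENNReal.toReal_strict_mono (by simp [ENNReal.mul_eq_top]) hp2
      rw [ENNReal.toReal_mul, ENNReal.toReal_mul, ENNReal.toReal_add (by simp) (by simp)] at h
      simpa using h
    have hP2 : p.toReal < 2 := by nlinarith
    set P := p.toReal with hPdef
    set Q := p'.toReal with hQdef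
    have hpP : p = ENNReal.ofReal P := (ENNReal.ofReal_toReal hpt).symm
    have hpQ : p' = ENNReal.ofReal Q := (ENNReal.ofReal_toReal hp't).symm
    have hQ2 : 0 < Q - 2 := by
      have h := hPQ.sub_one_mul_conj
      have := hPQ.sub_one_pos
      nlinarith
    have hQ0 := hPQ.symm.pos
    set D : ℝ := (Q * (4 / (Q - 2)) * 2 ^ (Q - 2)) ^ (1 / Q) with hD
    have hD0 : 0 ≤ D := by positivity
    set γ : ℝ := d / 2 * (2 / P - 1) with hγdef
    -- Equivalent to `P (d + 2) < 2d`, the upper bound on `p`.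
    have hγ : 1 < γ := by
      have hP0 : 0 < P := by linarith
      have e : γ = d * (2 - P) / (2 * P) := by rw [hγdef]; field_simp
      rw [e, lt_div_iff₀ (by positivity)]
      linarith
    refine ⟨(∑' n : ℤ, D * 4 ^ γ * |(n : ℝ)| ^ (-γ)).toNNReal, fun f hf hfp hv => ?_⟩
    rw [memLp_one_iff_integrable] at hf
    refine eLpNorm_le_of_dispersive (by rw [hfin]; exact hd) hf
      (fun n hn ξ hξ => fourier_eq_zero_of_norm_sq_eq hd hf hv hn hξ) hp'1 hD0 hγ
      (fun z hz => ?_)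
    rw [hpP] at hfp ⊢
    rw [hpQ]
    have h := eLpNorm_gaussOp_le hPQ hP2 hz hf hfp
    rwa [hfin, ← Real.rpow_mul (by positivity)] at h

end VanishingPeriodizations

theorem corollary1 (d : ℕ) (hd : 3 ≤ d) (p p' : ℝ≥0∞) (hp1 : 1 ≤ p)
    (hp2 : p < 2 * (d : ℝ≥0∞) / ((d : ℝ≥0∞) + 2)) (hpp' : ENNReal.HolderConjugate p p') :
    ∃ C : ℝ≥0, ∀ f : EuclideanSpace ℝ (Fin d) → ℂ,
      MemLp f 1 volume → MemLp f p volume →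
      VanishingPeriodizations.HasVanishingPeriodizations f →
      ∀ r : ℝ≥0∞, p ≤ r → r ≤ p' →
        MemLp f r volume ∧ eLpNorm f r volume ≤ (C : ℝ≥0∞) * eLpNorm f p volume := by
  obtain ⟨C, hC⟩ := VanishingPeriodizations.exists_eLpNorm_conjugate_le d hd p p' hp1 hp2 hpp'
  -- The maximum with 1 makes `max 1 C · ‖f‖_p` dominate both endpoint norms; the 2 comes from the
  -- intermediate exponents.
  refine ⟨2 * max 1 C, fun f hf hfp hv r hpr hrp' => ?_⟩
  have hle : eLpNorm f r volume ≤ ((2 * max 1 C : ℝ≥0) : ℝ≥0∞) * eLpNorm f p volume := by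
    rcases eq_or_ne (eLpNorm f p volume) 0 with h0 | h0
    · have hp0 : p ≠ 0 := (zero_lt_one.trans_le hp1).ne'
      rw [eLpNorm_congr_ae ((eLpNorm_eq_zero_iff hfp.1 hp0).1 h0), eLpNorm_zero]
      exact zero_le
    · have hm1 : (1 : ℝ≥0∞) ≤ ((max 1 C : ℝ≥0) : ℝ≥0∞) := by
        exact_mod_cast le_max_left 1 C
      have hm2 : (C : ℝ≥0∞) ≤ ((max 1 C : ℝ≥0) : ℝ≥0∞) := by
        exact_mod_cast le_max_right 1 C
      have h := VanishingPeriodizations.eLpNorm_le_two_mul_of_le_of_le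
        (a := ((max 1 C : ℝ≥0) : ℝ≥0∞) * eLpNorm f p volume) hfp.1 hp1 hpr hrp'
        (mul_ne_zero (zero_lt_one.trans_le hm1).ne' h0)
        (ENNReal.mul_ne_top ENNReal.coe_ne_top hfp.2.ne)
        (le_mul_of_one_le_left zero_le hm1)
        ((hC f hf hfp hv).trans (by gcongr))
      rwa [ENNReal.coe_mul, mul_assoc]
  exact ⟨⟨hfp.1, hle.trans_lt (ENNReal.mul_lt_top ENNReal.coe_lt_top hfp.2)⟩, hle⟩
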